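/- Let $X$ be a smooth manifold, with regular Hausdorff topology, modeled on a real Hilbert space $H$ (possibly infinite-dimensional, not necessarily separable), and let $g$ be a smooth strong Riemannian metric on $X$, i.e. a smoothly varying inner product on the tangent spaces that induces the given topology on each $T_xX$. (A complex Hilbert manifold with a Hermitian metric is included by taking its underlying real manifold and the real part of the metric.) Smooth means $C^\infty$. Let $G$ be an arbitrary (discrete) group acting on $X$ by smooth isometries, and let $Y\subset X$ be a smooth submanifold (locally closed: near each point of $Y$ there is a chart of $X$ in which $Y$ corresponds to a closed linear subspace of $H$) such that $aY\subset Y$ for all $a\in G$. Let $$N(Y)=\{(y,v) : y\in Y,\ v\in T_yX,\ g_y(v,w)=0 \text{ for all } w\in T_yY\}\subset T(X)|_Y$$ be the orthogonal normal bundle, with the subspace topology from $T(X)$; $G$ acts on it by $a\cdot(y,v)=(ay,\,d(a)_y v)$. Assume that $N(Y)$ is a smooth vector subbundle of $T(X)|_Y$. Then $Y$ has a $G$-invariant total tubular neighborhood with $G$-equivariant homeomorphism: there exist an open set $\tau(Y)\subset X$ with $Y\subset\tau(Y)$ and $a\,\tau(Y)\subset\tau(Y)$ for all $a\in G$, and a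 homeomorphism $\phi\colon N(Y)\to\tau(Y)$ such that $\phi(y,0)=y$ for all $y\in Y$ and $\phi(a\cdot p)=a\,\phi(p)$ for all $a\in G$, $p\in N(Y)$. (No smoothness of $\phi$ is asserted.) -/

import Mathlib

open Set Filter Topology Bundle
open scoped Manifold ContDiff

noncomputable section

namespace InvTubular

variable {H : Type*} [NormedAddCommGroup H] [InnerProductSpace ℝ H]
  {X : Type*} [TopologicalSpace X] [ChartedSpace H X]

/-- `Y` is a smooth (embedded, hence locally closed) submanifold of the manifold `X`: around every
point of `Y` there is a chart of the smooth structure of `X` in which `Y` corresponds to a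
closed linear subspace `F` of the model Hilbert space (closed subspaces of a Hilbert space are
complemented). The subspace may vary with the point, so that different components of `Y` may have
different dimensions. -/
def IsSubmanifold (Y : Set X) : Prop :=
  ∀ y ∈ Y, ∃ φ ∈ IsManifold.maximalAtlas 𝓘(ℝ, H) ∞ X, y ∈ φ.source ∧
    ∃ F : Submodule ℝ H, IsClosed (F : Set H) ∧ ∀ x ∈ φ.source, (x ∈ Y ↔ φ x ∈ F)

/-- The tangent bundle `T(Y)` as a subset of `T(X)`: the set of all velocity vectors `γ'(0)` of
smooth curves `γ` in `X`, defined near `0`, that stay in `Y`. -/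
def tangentSet (Y : Set X) : Set (TangentBundle 𝓘(ℝ, H) X) :=
  {p | ∃ γ : ℝ → X, ContMDiffAt 𝓘(ℝ, ℝ) 𝓘(ℝ, H) ∞ γ 0 ∧ (∀ᶠ t in 𝓝 (0 : ℝ), γ t ∈ Y) ∧
    tangentMap 𝓘(ℝ, ℝ) 𝓘(ℝ, H) γ ⟨0, (1 : ℝ)⟩ = p}

variable [IsManifold 𝓘(ℝ, H) ∞ X]

variable (H X) in
/-- A smooth strong Riemannian metric on `X`: a smoothly varying inner product on the tangent spaces
which induces on each of them its given topology. A complex Hilbert manifold with a Hermitian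
metric `h` is covered through the underlying real manifold and the metric `Re h`, which has the
same norms, and the same orthogonal complements of complex subspaces; every isometry of `h` is one
of `Re h`. -/
abbrev StrongRiemannianMetric :=
  ContMDiffRiemannianMetric 𝓘(ℝ, H) ∞ H (fun x : X => TangentSpace 𝓘(ℝ, H) x)

/-- The abstract (discrete) group `G` acts on `X` by smooth maps preserving the metric. As the
inverse of the action of `a` is the action of `a⁻¹`, each group element acts by a smooth
isometric diffeomorphism. -/
structure ActsByIsometries (G : Type*) [Group G] [MulAction G X]
    (g : StrongRiemannianMetric H X) : Prop where
  smooth (a : G) : ContMDiff 𝓘(ℝ, H) 𝓘(ℝ, H) ∞ (fun x : X => a • x)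
  isometry (a : G) (x : X) (v w : TangentSpace 𝓘(ℝ, H) x) :
    g.inner (a • x) (mfderiv 𝓘(ℝ, H) 𝓘(ℝ, H) (fun z : X => a • z) x v)
      (mfderiv 𝓘(ℝ, H) 𝓘(ℝ, H) (fun z : X => a • z) x w) = g.inner x v w

/-- The induced action on tangent vectors: `a` acts on `T(X)` by the derivative of `x ↦ a • x`. -/
def tangentAct {G : Type*} [Group G] [MulAction G X] (a : G)
    (p : TangentBundle 𝓘(ℝ, H) X) : TangentBundle 𝓘(ℝ, H) X :=
  tangentMap 𝓘(ℝ, H) 𝓘(ℝ, H) (fun x : X => a • x) p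

/-- The orthogonal normal bundle `N(Y)`, as a subset of `T(X)`: the vectors of `T(X)` at points of
`Y` which are orthogonal to all tangent vectors of `Y` at that point. It carries the subspace
topology. -/
def normalSet (g : StrongRiemannianMetric H X) (Y : Set X) : Set (TangentBundle 𝓘(ℝ, H) X) :=
  {p | p.proj ∈ Y ∧ ∀ w : TangentSpace 𝓘(ℝ, H) p.proj,
    (⟨p.proj, w⟩ : TangentBundle 𝓘(ℝ, H) X) ∈ tangentSet Y → g.inner p.proj p.2 w = 0}

/-- The subset `N` of `T(X)|_Y` is a smooth vector subbundle of `T(X)|_Y`: around every point of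
`Y` there is a smooth, fibrewise linear local trivialization of `T(X)`, with model fibre `H`, which
over `Y` carries `N` to the trivial subbundle with fibre a fixed closed subspace `K` of `H`. (For a
submanifold `Y`, the smooth local trivializations of `T(X)|_Y` are, locally on `Y`, exactly the
restrictions to `Y` of smooth local trivializations of `T(X)`.) -/
def IsSmoothSubbundleOver (Y : Set X) (N : Set (TangentBundle 𝓘(ℝ, H) X)) : Prop :=
  ∀ y ∈ Y, ∃ e : Trivialization H (TotalSpace.proj : TangentBundle 𝓘(ℝ, H) X → X),
    y ∈ e.baseSet ∧ e.IsLinear ℝ ∧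
    ContMDiffOn 𝓘(ℝ, H).tangent (𝓘(ℝ, H).prod 𝓘(ℝ, H)) ∞ e e.source ∧
    ContMDiffOn (𝓘(ℝ, H).prod 𝓘(ℝ, H)) 𝓘(ℝ, H).tangent ∞ e.toOpenPartialHomeomorph.symm e.target ∧
    ∃ K : Submodule ℝ H, IsClosed (K : Set H) ∧
      ∀ p : TangentBundle 𝓘(ℝ, H) X, p.proj ∈ e.baseSet → p.proj ∈ Y → (p ∈ N ↔ (e p).2 ∈ K)

/-- A tubular neighborhood of `Y` in `X`: an open neighborhood `nhd` of `Y`, together with a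
homeomorphism onto it from an open neighborhood `domain` of the zero section in the normal bundle
`N(Y)`, restricting to the identity on `Y` (identified with the zero section). -/
structure TubularNeighborhood (g : StrongRiemannianMetric H X) (Y : Set X) where
  domain : Set (TangentBundle 𝓘(ℝ, H) X)
  isOpen_domain : ∃ W : Set (TangentBundle 𝓘(ℝ, H) X), IsOpen W ∧ domain = normalSet g Y ∩ W
  zero_mem : ∀ y ∈ Y, (⟨y, 0⟩ : TangentBundle 𝓘(ℝ, H) X) ∈ domain
  nhd : Set X
  isOpen_nhd : IsOpen nhd
  subset_nhd : Y ⊆ nhd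
  toHomeomorph : domain ≃ₜ nhd
  map_zero : ∀ (y : X) (hy : y ∈ Y), (toHomeomorph ⟨⟨y, 0⟩, zero_mem y hy⟩ : X) = y

namespace TubularNeighborhood

variable {g : StrongRiemannianMetric H X} {Y : Set X}

/-- The tubular neighborhood is total if its homeomorphism is defined on all of `N(Y)`. -/
def IsTotal (T : TubularNeighborhood g Y) : Prop :=
  T.domain = normalSet g Y

/-- The open set `τ(Y)` is `G`-invariant. -/
def IsInvariant (G : Type*) [Group G] [MulAction G X] (T : TubularNeighborhood g Y) : Prop :=
  ∀ a : G, ∀ x ∈ T.nhd, a • x ∈ T.nhd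

/-- The homeomorphism is `G`-equivariant: its domain is `G`-invariant and it commutes with the
actions of `G` on `T(X)` and on `X`. -/
def IsEquivariant (G : Type*) [Group G] [MulAction G X] (T : TubularNeighborhood g Y) : Prop :=
  ∀ (a : G) (p : T.domain), ∃ h : tangentAct a p.1 ∈ T.domain,
    (T.toHomeomorph ⟨tangentAct a p.1, h⟩ : X) = a • (T.toHomeomorph p : X)

end TubularNeighborhood

end InvTubular

end

/-!
The tubular neighbourhood is the image of the normal bundle `N(Y)` under the geodesic exponential
map of `g`, restricted to vectors shorter than a `G`-invariant radius function. Isometries map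
geodesics to geodesics and preserve the Riemannian distance, so that all constructions below are
equivariant; no averaging over `G`, and no partition of unity, is needed.

*Local structure.* In coordinates a geodesic solves `u'' = Γ (u, u')`, with `Γ` quadratic in the
velocity. Hence geodesics with small initial velocity `v` live up to time `1`
(`exists_solution_near`), and the exponential map has the strict derivative `(x, v) ↦ x + v` at
zero vectors (`hasStrictFDerivAt_expMap`). In coordinates of `N(Y)`, which are available because
`N(Y)` is a subbundle, this derivative becomes the sum map from the tangent and the normal space of
`Y`. It is bijective because the metric is strong (`bijective_add_of_normalSet`). By the inverse
function theorem, the exponential map embeds a neighbourhood of each zero vector of `N(Y)` as an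
open set (`exists_openEmbedsOn_expMap`). Uniqueness of geodesics makes the exponential map
well defined, and hence equivariant (`IsGeodesicFrom.unique`, `expMap_tangentAct`).

*Gluing.* Let `d` be the Riemannian distance, and let `r y` be the supremum of the radii `≤ 1` such
that the exponential map embeds the set of normal vectors of length `< r` at points of distance
`< r` to `y`. The function `r` is `1`-Lipschitz, positive on `Y`, and invariant. In the same manner,
there is a radius function `s` such that normal vectors at `y` shorter than `s y` are moved by less
than `r y / 4`. If `ρ = min r s / 2`, then two normal vectors shorter than `ρ` with the same image
have base points so close that both lie in a common set where the exponential map is injective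
(`exists_invariant_radius`). The fibrewise radial map `v ↦ ρ / (1 + ‖v‖) • v` finally makes the
neighbourhood total (`isOpenEmbedding_shrink`, `exists_total_equivariant_tube`).
-/

namespace InvTubular

/-! ### Second-order equations which are quadratic in the velocity -/

section SecondOrder

variable {E : Type*} [NormedAddCommGroup E] [NormedSpace ℝ E]

/-- The first-order vector field on `E × E` of the second-order equation `u'' = Γ (u, u')`. -/
def sprayField (Γ : E × E → E) (q : E × E) : E × E := (q.2, Γ q)

lemma contDiffAt_sprayField {Γ : E × E → E} {q : E × E} {n : WithTop ℕ∞}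
    (hΓ : ContDiffAt ℝ n Γ q) : ContDiffAt ℝ n (sprayField Γ) q :=
  contDiffAt_snd.prodMk hΓ

lemma _root_.HasDerivAt.prod_fst {p : ℝ → E × E} {p' : E × E} {t : ℝ} (h : HasDerivAt p p' t) :
    HasDerivAt (fun s => (p s).1) p'.1 t :=
  (hasFDerivAt_fst (𝕜 := ℝ) (E := E) (F := E) (p := p t)).comp_hasDerivAt t h

lemma _root_.HasDerivAt.prod_snd {p : ℝ → E × E} {p' : E × E} {t : ℝ} (h : HasDerivAt p p' t) :
    HasDerivAt (fun s => (p s).2) p'.2 t :=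
  (hasFDerivAt_snd (𝕜 := ℝ) (E := E) (F := E) (p := p t)).comp_hasDerivAt t h

/-- A map which is quadratic in its second variable is flat along the zero section. -/
lemma hasStrictFDerivAt_zero_of_quadratic {Γ : E × E → E} {x₀ : E}
    (hΓ : ContDiffAt ℝ 1 Γ (x₀, 0)) (hq : ∀ x v (s : ℝ), Γ (x, s • v) = s ^ 2 • Γ (x, v)) :
    HasStrictFDerivAt Γ (0 : E × E →L[ℝ] E) (x₀, 0) := by
  have h := hΓ.hasStrictFDerivAt one_ne_zero
  have h0 : ∀ x, Γ (x, 0) = 0 := fun x => by simpa using hq x 0 0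
  suffices hz : fderiv ℝ Γ (x₀, 0) = 0 by rwa [hz] at h
  apply ContinuousLinearMap.prod_ext <;> ext x
  · have h1 : HasFDerivAt (fun x : E => Γ (x, 0)) _ x₀ :=
      h.hasFDerivAt.comp x₀ (f := fun x : E => (x, (0 : E)))
        ((hasFDerivAt_id x₀).prodMk (hasFDerivAt_const (0 : E) x₀))
    simp only [h0] at h1
    have := congrArg (fun L : E →L[ℝ] E => L x) (h1.unique (hasFDerivAt_const (0 : E) x₀))
    simpa using this
  · have hl : HasDerivAt (fun s : ℝ => ((x₀, s • x) : E × E)) (0, x) 0 :=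
      (hasDerivAt_const _ _).prodMk (by simpa using (hasDerivAt_id (0 : ℝ)).smul_const x)
    have h1 : HasDerivAt (fun s : ℝ => Γ (x₀, s • x)) (fderiv ℝ Γ (x₀, 0) (0, x)) 0 := by
      have h' : HasFDerivAt Γ (fderiv ℝ Γ (x₀, 0)) (x₀, (0 : ℝ) • x) := by
        simpa using h.hasFDerivAt
      exact h'.comp_hasDerivAt 0 hl
    simp only [hq] at h1
    have h2 : HasDerivAt (fun s : ℝ => s ^ 2 • Γ (x₀, x)) 0 0 := by
      simpa using (hasDerivAt_pow 2 (0 : ℝ)).smul_const (Γ (x₀, x))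
    simpa using h1.unique h2

/-- Local uniqueness for `u'' = Γ (u, u')`. -/
lemma sprayField_unique {Γ : E × E → E} {q : E × E} (hΓ : ContDiffAt ℝ 1 Γ q)
    {p₁ p₂ : ℝ → E × E} {t : ℝ}
    (h₁ : ∀ᶠ s in 𝓝 t, HasDerivAt p₁ (sprayField Γ (p₁ s)) s)
    (h₂ : ∀ᶠ s in 𝓝 t, HasDerivAt p₂ (sprayField Γ (p₂ s)) s)
    (e₁ : p₁ t = q) (e₂ : p₂ t = q) : p₁ =ᶠ[𝓝 t] p₂ := by
  obtain ⟨K, s, hs, hK⟩ := (contDiffAt_sprayField hΓ).exists_lipschitzOnWith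
  have c₁ : ∀ᶠ r in 𝓝 t, p₁ r ∈ s :=
    h₁.self_of_nhds.continuousAt.eventually_mem (by rwa [e₁])
  have c₂ : ∀ᶠ r in 𝓝 t, p₂ r ∈ s :=
    h₂.self_of_nhds.continuousAt.eventually_mem (by rwa [e₂])
  exact ODE_solution_unique_of_eventually (v := fun _ => sprayField Γ) (s := fun _ => s)
    (Eventually.of_forall fun _ => hK) (h₁.and c₁) (h₂.and c₂) (e₁.trans e₂.symm)

/-- Solutions of `u'' = Γ (u, u')` with `Γ` quadratic in the velocity, starting close to the rest
point `x₀` with small velocity, exist on the whole interval `(-1, 2)` and stay close to `x₀`. -/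
lemma exists_solution_near [CompleteSpace E] {Γ : E × E → E} {x₀ : E}
    (hΓ : ContDiffAt ℝ 1 Γ (x₀, 0)) (hq : ∀ x v (s : ℝ), Γ (x, s • v) = s ^ 2 • Γ (x, v))
    {U : Set (E × E)} (hU : U ∈ 𝓝 (x₀, (0 : E))) :
    ∀ᶠ q in 𝓝 (x₀, (0 : E)), ∃ p : ℝ → E × E, p 0 = q ∧
      ∀ t ∈ Ioo (-1 : ℝ) 2, p t ∈ U ∧ HasDerivAt p (sprayField Γ (p t)) t := by
  obtain ⟨K, s, hs, hK⟩ := (contDiffAt_sprayField hΓ).exists_lipschitzOnWith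
  obtain ⟨a, ha, has⟩ := Metric.nhds_basis_closedBall.mem_iff.1 (inter_mem hs hU)
  have hZ0 : sprayField Γ (x₀, 0) = 0 := by
    have : Γ (x₀, 0) = 0 := by simpa using hq x₀ 0 0
    simp [sprayField, this]
  have hb : ∀ q ∈ Metric.closedBall (x₀, (0 : E)) a, ‖sprayField Γ q‖ ≤ K * a := by
    intro q hq
    have := hK.dist_le_mul q (has hq).1 (x₀, 0) (mem_of_mem_nhds hs)
    rw [hZ0, dist_zero_right] at this
    exact this.trans (by gcongr; exact hq)
  -- The field is multiplied by `c`, so that it is small enough for its solutions to live on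
  -- `[-2, 2]`. As `Γ` is quadratic, multiplying their velocity by `c` solves the given equation.
  obtain ⟨c, hc0, hc1, hcK⟩ : ∃ c : ℝ, 0 < c ∧ c ≤ 1 ∧ c * (K * a) * 2 ≤ a / 2 := by
    refine ⟨1 / (4 * (K + 1)), by positivity, ?_, ?_⟩
    · rw [div_le_one (by positivity)]; linarith [K.2]
    · have : (K : ℝ) / (K + 1) ≤ 1 := by rw [div_le_one (by positivity)]; linarith
      calc 1 / (4 * ((K : ℝ) + 1)) * (K * a) * 2 = K / (K + 1) * (a / 2) := by field_simp; ring
        _ ≤ 1 * (a / 2) := by gcongr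
        _ = a / 2 := one_mul _
  have hPL : IsPicardLindelof (fun _ q => c • sprayField Γ q) (tmin := -2) (tmax := 2)
      ⟨0, by norm_num⟩ (x₀, (0 : E)) (.mk a ha.le) (.mk (a / 2) (by positivity))
      (.mk (c * (K * a)) (by positivity)) (.mk c hc0.le * K) := by
    refine IsPicardLindelof.of_time_independent (f := fun q => c • sprayField Γ q) ?_ ?_ ?_
    · intro q hq
      rw [norm_smul, Real.norm_of_nonneg hc0.le]
      exact mul_le_mul_of_nonneg_left (hb q hq) hc0.le
    · have := (lipschitzWith_smul (β := E × E) c).comp_lipschitzOnWith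
        (hK.mono fun q hq => (has hq).1)
      have hcc : ‖c‖₊ = .mk c hc0.le := by ext; simp [abs_of_pos hc0]
      rw [hcc] at this
      exact this
    · have h1 : max ((2 : ℝ) - 0) (0 - (-2)) = 2 := by norm_num
      simp only [h1, NNReal.coe_mk]
      linarith
  have hcont : Tendsto (fun q : E × E => (q.1, c⁻¹ • q.2)) (𝓝 (x₀, 0)) (𝓝 (x₀, (0 : E))) := by
    have : Continuous (fun q : E × E => (q.1, c⁻¹ • q.2)) := by fun_prop
    simpa using this.tendsto (x₀, 0)
  filter_upwards [hcont (Metric.closedBall_mem_nhds _ (half_pos ha))] with q hq'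
  have hx : (q.1, c⁻¹ • q.2) ∈ Metric.closedBall (x₀, (0 : E))
      (NNReal.mk (a / 2) (by positivity)) := hq'
  obtain ⟨β, h0, hmem, hder⟩ : ∃ β : ℝ → E × E, β 0 = (q.1, c⁻¹ • q.2) ∧
      (∀ t, β t ∈ Metric.closedBall (x₀, (0 : E)) a) ∧
      ∀ t ∈ Ioo (-1 : ℝ) 2, HasDerivAt β (c • sprayField Γ (β t)) t := by
    obtain ⟨α, hα⟩ := ODE.FunSpace.exists_isFixedPt_next hPL hx
    have hmem : ∀ t, α.compProj t ∈ Metric.closedBall (x₀, (0 : E)) a := fun t =>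
      α.compProj_mem_closedBall hPL.mul_max_le
    refine ⟨α.compProj, ?_, hmem, fun t ht => ?_⟩
    · have h1 : α.compProj 0 = α ⟨0, by norm_num⟩ :=
        ODE.FunSpace.compProj_val (α := α) (t := ⟨0, by norm_num⟩)
      rw [h1, ← hα, ODE.FunSpace.next_apply₀]
    · have ht' : t ∈ Icc (-2 : ℝ) 2 := ⟨by linarith [ht.1], ht.2.le⟩
      have h1 : HasDerivWithinAt α.compProj (c • sprayField Γ (α.compProj t)) (Icc (-2) 2) t := by
        apply ODE.hasDerivWithinAt_picard_Icc (t₀ := 0) (by norm_num) hPL.continuousOn_uncurry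
          α.continuous_compProj.continuousOn (fun _ _ => hmem _) (q.1, c⁻¹ • q.2) ht'
          |>.congr_of_mem _ ht'
        intro t' ht''
        rw [ODE.FunSpace.compProj_of_mem ht'']
        nth_rw 1 [← hα]
        rfl
      exact h1.hasDerivAt (Icc_mem_nhds (by linarith [ht.1]) ht.2)
  refine ⟨fun t => ((β t).1, c • (β t).2), ?_, fun t ht => ⟨?_, ?_⟩⟩
  · simp [h0, smul_smul, hc0.ne']
  · refine (has ?_).2
    have := hmem t
    rw [mem_closedBall_iff_norm] at this ⊢
    refine le_trans ?_ this
    rw [Prod.norm_def, Prod.norm_def]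
    refine max_le_max (le_of_eq (by simp)) ?_
    simp only [Prod.snd_sub, sub_zero, norm_smul, Real.norm_of_nonneg hc0.le]
    exact mul_le_of_le_one_left (norm_nonneg _) hc1
  · have h1 := hder t ht
    have h2 := h1.prod_fst.prodMk (h1.prod_snd.const_smul c)
    have e : sprayField Γ ((β t).1, c • (β t).2) =
        ((c • sprayField Γ (β t)).1, c • (c • sprayField Γ (β t)).2) := by
      simp [sprayField, hq, smul_smul, sq]
    exact e ▸ h2

/-- The time-one map of `u'' = Γ (u, u')`, with `Γ` quadratic in the velocity, is strictly
differentiable at `(x₀, 0)` with derivative `(x, v) ↦ x + v`. This is stated as an estimate for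
pairs of solutions. -/
lemma norm_solution_sub_le {Γ : E × E → E} {x₀ : E}
    (hΓ : ContDiffAt ℝ 1 Γ (x₀, 0)) (hq : ∀ x v (s : ℝ), Γ (x, s • v) = s ^ 2 • Γ (x, v))
    {κ : ℝ} (hκ : 0 < κ) :
    ∃ U ∈ 𝓝 (x₀, (0 : E)), ∀ p₁ p₂ : ℝ → E × E,
      (∀ t ∈ Icc (0 : ℝ) 1, p₁ t ∈ U ∧ HasDerivAt p₁ (sprayField Γ (p₁ t)) t) →
      (∀ t ∈ Icc (0 : ℝ) 1, p₂ t ∈ U ∧ HasDerivAt p₂ (sprayField Γ (p₂ t)) t) →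
      ‖(p₁ 1).1 - (p₂ 1).1 - (((p₁ 0).1 - (p₂ 0).1) + ((p₁ 0).2 - (p₂ 0).2))‖
        ≤ κ * ‖p₁ 0 - p₂ 0‖ := by
  obtain ⟨k, hk0, hk1, hk3⟩ : ∃ k : NNReal, 0 < k ∧ k ≤ 1 ∧ 3 * (k : ℝ) ≤ κ := by
    refine ⟨min 1 (.mk (κ / 3) (by positivity)), lt_min one_pos (by
      rw [← NNReal.coe_lt_coe]; simpa using hκ), min_le_left _ _, ?_⟩
    have : ((min 1 (.mk (κ / 3) (by positivity)) : NNReal) : ℝ) ≤ κ / 3 := by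
      exact_mod_cast min_le_right (1 : NNReal) (.mk (κ / 3) (by positivity))
    linarith
  -- as `Γ` is flat along the zero section, it has the small Lipschitz constant `k` near `(x₀, 0)`
  obtain ⟨U, hU, hL⟩ :=
    (hasStrictFDerivAt_zero_of_quadratic hΓ hq).exists_lipschitzOnWith_of_nnnorm_lt
      k (by simpa using hk0)
  refine ⟨U, hU, fun p₁ p₂ h₁ h₂ => ?_⟩
  have hZ : LipschitzOnWith 1 (sprayField Γ) U := by
    refine LipschitzOnWith.of_dist_le_mul fun x hx y hy => ?_
    rw [NNReal.coe_one, one_mul, sprayField, sprayField, Prod.dist_eq]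
    refine max_le (le_max_right _ _) ((hL.dist_le_mul x hx y hy).trans ?_)
    exact mul_le_of_le_one_left dist_nonneg (by exact_mod_cast hk1)
  set d := ‖p₁ 0 - p₂ 0‖ with hd
  -- Grönwall's inequality; the constant `3` bounds `exp 1`
  have hgr : ∀ t ∈ Icc (0 : ℝ) 1, dist (p₁ t) (p₂ t) ≤ 3 * d := by
    intro t ht
    have := dist_le_of_trajectories_ODE_of_mem (v := fun _ => sprayField Γ) (s := fun _ => U)
      (K := 1) (f := p₁) (g := p₂) (a := 0) (b := 1) (δ := d) (fun _ _ => hZ)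
      (fun t ht => (h₁ t ht).2.continuousAt.continuousWithinAt)
      (fun t ht => (h₁ t (Ico_subset_Icc_self ht)).2.hasDerivWithinAt)
      (fun t ht => (h₁ t (Ico_subset_Icc_self ht)).1)
      (fun t ht => (h₂ t ht).2.continuousAt.continuousWithinAt)
      (fun t ht => (h₂ t (Ico_subset_Icc_self ht)).2.hasDerivWithinAt)
      (fun t ht => (h₂ t (Ico_subset_Icc_self ht)).1) (by rw [hd, dist_eq_norm]) t ht
    refine this.trans ?_
    have h3 : Real.exp ((1 : NNReal) * (t - 0)) ≤ 3 := by
      refine (Real.exp_le_exp.2 (?_ : _ ≤ (1 : ℝ))).trans ?_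
      · simpa using ht.2
      · exact (Real.exp_one_lt_d9.trans (by norm_num)).le
    nlinarith [norm_nonneg (p₁ 0 - p₂ 0)]
  have hv : ∀ t ∈ Icc (0 : ℝ) 1,
      ‖((p₁ t).2 - (p₂ t).2) - ((p₁ 0).2 - (p₂ 0).2)‖ ≤ κ * d := by
    intro t ht
    have := norm_image_sub_le_of_norm_deriv_le_segment' (f := fun t => (p₁ t).2 - (p₂ t).2)
      (f' := fun t => Γ (p₁ t) - Γ (p₂ t)) (C := κ * d) (a := 0) (b := 1)
      (fun t ht => ((h₁ t ht).2.prod_snd.sub (h₂ t ht).2.prod_snd).hasDerivWithinAt)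
      (fun t ht => ?_) t ht
    · refine this.trans (mul_le_of_le_one_right (by positivity) (by linarith [ht.2]))
    · have ht' := Ico_subset_Icc_self ht
      rw [← dist_eq_norm]
      refine (hL.dist_le_mul _ (h₁ t ht').1 _ (h₂ t ht').1).trans ?_
      calc (k : ℝ) * dist (p₁ t) (p₂ t) ≤ k * (3 * d) := by gcongr; exact hgr t ht'
        _ = 3 * k * d := by ring
        _ ≤ κ * d := by gcongr
  have := norm_image_sub_le_of_norm_deriv_le_segment'
      (f := fun t => (p₁ t).1 - (p₂ t).1 - t • ((p₁ 0).2 - (p₂ 0).2))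
      (f' := fun t => ((p₁ t).2 - (p₂ t).2) - ((p₁ 0).2 - (p₂ 0).2)) (C := κ * d) (a := 0) (b := 1)
      (fun t ht => (((h₁ t ht).2.prod_fst.sub (h₂ t ht).2.prod_fst).sub (by
        simpa using (hasDerivAt_id t).smul_const ((p₁ 0).2 - (p₂ 0).2))).hasDerivWithinAt)
      (fun t ht => hv t (Ico_subset_Icc_self ht)) 1 (by norm_num)
  simp only [one_smul, zero_smul, sub_zero, mul_one] at this
  convert this using 2
  abel

end SecondOrder


/-! ### Metrics and geodesics in a coordinate domain -/

section MetricCalculus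

variable {E : Type*} [NormedAddCommGroup E] [NormedSpace ℝ E]

-- Shortcuts for the instance search on spaces of bilinear and trilinear forms.
noncomputable instance instNormedAddCommGroupBilin : NormedAddCommGroup (E →L[ℝ] E →L[ℝ] ℝ) :=
  ContinuousLinearMap.toNormedAddCommGroup

noncomputable instance instNormedSpaceBilin : NormedSpace ℝ (E →L[ℝ] E →L[ℝ] ℝ) :=
  ContinuousLinearMap.toNormedSpace

noncomputable instance instNormedAddCommGroupTrilin :
    NormedAddCommGroup (E →L[ℝ] E →L[ℝ] E →L[ℝ] ℝ) :=
  ContinuousLinearMap.toNormedAddCommGroup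

noncomputable instance instNormedSpaceTrilin : NormedSpace ℝ (E →L[ℝ] E →L[ℝ] E →L[ℝ] ℝ) :=
  ContinuousLinearMap.toNormedSpace

/-- The geodesic equation of the metric `g` in a coordinate domain, at a point `x`, for a curve
with velocity `v` and acceleration `a`, tested against all vectors `w`. -/
def GeodesicEq (g : E → E →L[ℝ] E →L[ℝ] ℝ) (x v a : E) : Prop :=
  ∀ w, g x a w + fderiv ℝ g x v v w = 2⁻¹ * fderiv ℝ g x w v v

/-- The curve `u` is twice differentiable at `t` and satisfies the geodesic equation of `g` there. -/
def CoordGeodesicAt (g : E → E →L[ℝ] E →L[ℝ] ℝ) (u : ℝ → E) (t : ℝ) : Prop :=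
  (∀ᶠ s in 𝓝 t, DifferentiableAt ℝ u s) ∧ DifferentiableAt ℝ (deriv u) t ∧
    GeodesicEq g (u t) (deriv u t) (deriv (deriv u) t)

lemma CoordGeodesicAt.congr {g : E → E →L[ℝ] E →L[ℝ] ℝ} {u u' : ℝ → E} {t : ℝ}
    (h : CoordGeodesicAt g u t) (he : u' =ᶠ[𝓝 t] u) : CoordGeodesicAt g u' t := by
  obtain ⟨h1, h2, h3⟩ := h
  refine ⟨?_, ?_, ?_⟩
  · filter_upwards [h1, he.eventuallyEq_nhds] with s hs hs'
    exact hs'.differentiableAt_iff.2 hs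
  · exact he.deriv.differentiableAt_iff.2 h2
  · rwa [he.eq_of_nhds, he.deriv.eq_of_nhds, he.deriv.deriv_eq]

/-- The acceleration given by the geodesic equation, as a function of position and velocity. -/
noncomputable def spray (g : E → E →L[ℝ] E →L[ℝ] ℝ) (q : E × E) : E :=
  (g q.1).inverse ((2⁻¹ : ℝ) • ((fderiv ℝ g q.1).flip q.2).flip q.2 - fderiv ℝ g q.1 q.2 q.2)

lemma spray_smul (g : E → E →L[ℝ] E →L[ℝ] ℝ) (x v : E) (s : ℝ) :
    spray g (x, s • v) = s ^ 2 • spray g (x, v) := by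
  simp only [spray, ← map_smul]
  congr 1
  ext w
  simp
  ring

lemma geodesicEq_iff {g : E → E →L[ℝ] E →L[ℝ] ℝ} {x v a : E} (hg : (g x).IsInvertible) :
    GeodesicEq g x v a ↔ a = spray g (x, v) := by
  have key : GeodesicEq g x v a ↔ g x a =
      (2⁻¹ : ℝ) • ((fderiv ℝ g x).flip v).flip v - fderiv ℝ g x v v := by
    rw [GeodesicEq, ContinuousLinearMap.ext_iff]
    refine forall_congr' fun w => ?_
    simp
    rw [eq_sub_iff_add_eq]
  obtain ⟨e, he⟩ := hg
  rw [key, spray, ← he, ContinuousLinearMap.inverse_equiv]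
  exact (e.eq_symm_apply).symm

lemma contDiffAt_spray [CompleteSpace E] {g : E → E →L[ℝ] E →L[ℝ] ℝ} {x v : E}
    (hg : ContDiffAt ℝ ∞ g x) (hi : (g x).IsInvertible) : ContDiffAt ℝ 1 (spray g) (x, v) := by
  obtain ⟨e, he⟩ := hi
  have h1 : ContDiffAt ℝ 1 g x := hg.of_le (by simp)
  have h2 : ContDiffAt ℝ 1 (fderiv ℝ g) x := hg.fderiv_right (by norm_cast)
  have h1' : ContDiffAt ℝ 1 (fun q : E × E => (g q.1).inverse) (x, v) := by
    have : ContDiffAt ℝ 1 ContinuousLinearMap.inverse (g x) := by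
      rw [← he]; exact contDiffAt_map_inverse e
    exact (this.comp x h1).comp (x, v) contDiffAt_fst
  have h2' : ContDiffAt ℝ 1 (fun q : E × E => fderiv ℝ g q.1) (x, v) :=
    h2.comp (x, v) contDiffAt_fst
  have h3 : ContDiffAt ℝ 1 (fun q : E × E => (fderiv ℝ g q.1).flip q.2) (x, v) :=
    ((ContinuousLinearMap.flipₗᵢ ℝ E E (E →L[ℝ] ℝ)).contDiff.contDiffAt.comp (x, v) h2').clm_apply
      contDiffAt_snd
  have h4 : ContDiffAt ℝ 1 (fun q : E × E => ((fderiv ℝ g q.1).flip q.2).flip q.2) (x, v) :=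
    ((ContinuousLinearMap.flipₗᵢ ℝ E E ℝ).contDiff.contDiffAt.comp (x, v) h3).clm_apply
      contDiffAt_snd
  exact h1'.clm_apply ((h4.const_smul _).sub
    ((h2'.clm_apply contDiffAt_snd).clm_apply contDiffAt_snd))

/-- The geodesic equation is equivalent to the first-order system of its spray. -/
lemma CoordGeodesicAt.hasDerivAt {g : E → E →L[ℝ] E →L[ℝ] ℝ} {u : ℝ → E} {t : ℝ}
    (h : CoordGeodesicAt g u t) (hg : (g (u t)).IsInvertible) :
    HasDerivAt (fun s => (u s, deriv u s)) (sprayField (spray g) (u t, deriv u t)) t := by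
  obtain ⟨h1, h2, h3⟩ := h
  rw [geodesicEq_iff hg] at h3
  rw [sprayField, ← h3]
  exact h1.self_of_nhds.hasDerivAt.prodMk h2.hasDerivAt

lemma coordGeodesicAt_of_hasDerivAt {g : E → E →L[ℝ] E →L[ℝ] ℝ} {p : ℝ → E × E} {t : ℝ}
    (h : ∀ᶠ s in 𝓝 t, HasDerivAt p (sprayField (spray g) (p s)) s)
    (hg : (g (p t).1).IsInvertible) : CoordGeodesicAt g (fun s => (p s).1) t := by
  have h1 : ∀ᶠ s in 𝓝 t, HasDerivAt (fun s => (p s).1) (p s).2 s := by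
    filter_upwards [h] with s hs using hs.prod_fst
  have h2 : deriv (fun s => (p s).1) =ᶠ[𝓝 t] fun s => (p s).2 := by
    filter_upwards [h1] with s hs using hs.deriv
  have h3 := h.self_of_nhds.prod_snd
  refine ⟨?_, ?_, ?_⟩
  · filter_upwards [h1] with s hs using hs.differentiableAt
  · exact h2.differentiableAt_iff.2 h3.differentiableAt
  · rw [geodesicEq_iff hg, h2.deriv_eq, h2.eq_of_nhds, h3.deriv]
    rfl

/-- Invariance of the geodesic equation under a change of coordinates `φ` which pulls back the
metric `h` to `g`. -/
lemma CoordGeodesicAt.comp {g h : E → E →L[ℝ] E →L[ℝ] ℝ} {φ : E → E} {u : ℝ → E} {t : ℝ}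
    (hu : CoordGeodesicAt g u t) (hφ : ContDiffAt ℝ 2 φ (u t))
    (hg : DifferentiableAt ℝ g (u t)) (hh : DifferentiableAt ℝ h (φ (u t)))
    (hsymm : ∀ v w, h (φ (u t)) v w = h (φ (u t)) w v)
    (hgh : ∀ᶠ x in 𝓝 (u t), ∀ v w, g x v w = h (φ x) (fderiv ℝ φ x v) (fderiv ℝ φ x w))
    (hsurj : Function.Surjective (fderiv ℝ φ (u t))) :
    CoordGeodesicAt h (φ ∘ u) t := by
  obtain ⟨h1, h2, h3⟩ := hu
  set x := u t with hx
  set v := deriv u t with hv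
  set a := deriv (deriv u) t with ha
  have hφ1 : ∀ᶠ y in 𝓝 x, DifferentiableAt ℝ φ y := by
    filter_upwards [hφ.eventually (by simp)] with y hy using hy.differentiableAt (by simp)
  have hut : HasDerivAt u v t := h1.self_of_nhds.hasDerivAt
  have hd1 : ∀ᶠ s in 𝓝 t, HasDerivAt (φ ∘ u) (fderiv ℝ φ (u s) (deriv u s)) s := by
    filter_upwards [h1, hut.continuousAt.eventually hφ1] with s hs hs'
    exact hs'.hasFDerivAt.comp_hasDerivAt s hs.hasDerivAt
  have hd2 : deriv (φ ∘ u) =ᶠ[𝓝 t] fun s => fderiv ℝ φ (u s) (deriv u s) := by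
    filter_upwards [hd1] with s hs using hs.deriv
  have hφ2 : HasFDerivAt (fderiv ℝ φ) (fderiv ℝ (fderiv ℝ φ) x) x :=
    ((hφ.fderiv_right (m := 1) (by norm_num)).differentiableAt (by simp)).hasFDerivAt
  have hd3 : HasDerivAt (fun s => fderiv ℝ φ (u s) (deriv u s))
      (fderiv ℝ (fderiv ℝ φ) x v v + fderiv ℝ φ x a) t :=
    (hφ2.comp_hasDerivAt t hut).clm_apply h2.hasDerivAt
  have hsnd : ∀ v w, fderiv ℝ (fderiv ℝ φ) x v w = fderiv ℝ (fderiv ℝ φ) x w v :=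
    fun v w => (hφ.isSymmSndFDerivAt (by simp)) v w
  -- the derivative of the pulled-back metric, by the product rule
  have hD : ∀ z v w, fderiv ℝ g x z v w =
      fderiv ℝ h (φ x) (fderiv ℝ φ x z) (fderiv ℝ φ x v) (fderiv ℝ φ x w)
      + h (φ x) (fderiv ℝ (fderiv ℝ φ) x z v) (fderiv ℝ φ x w)
      + h (φ x) (fderiv ℝ φ x v) (fderiv ℝ (fderiv ℝ φ) x z w) := by
    intro z v w
    have e1 : HasFDerivAt (fun y => g y v w) _ x :=
      (hg.hasFDerivAt.clm_apply (hasFDerivAt_const v x)).clm_apply (hasFDerivAt_const w x)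
    have e2 : HasFDerivAt (fun y => h (φ y) (fderiv ℝ φ y v) (fderiv ℝ φ y w)) _ x :=
      ((hh.hasFDerivAt.comp x hφ1.self_of_nhds.hasFDerivAt).clm_apply
        (hφ2.clm_apply (hasFDerivAt_const v x))).clm_apply (hφ2.clm_apply (hasFDerivAt_const w x))
    have e3 : (fun y => g y v w) =ᶠ[𝓝 x]
        fun y => h (φ y) (fderiv ℝ φ y v) (fderiv ℝ φ y w) := by
      filter_upwards [hgh] with y hy using hy v w
    have := congrArg (fun L : E →L[ℝ] ℝ => L z) ((e1.congr_of_eventuallyEq e3.symm).unique e2)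
    simp at this
    rw [this]
    ring
  refine ⟨?_, ?_, ?_⟩
  · filter_upwards [hd1] with s hs using hs.differentiableAt
  · exact hd2.differentiableAt_iff.2 hd3.differentiableAt
  · rw [hd2.deriv_eq, hd2.eq_of_nhds, hd3.deriv]
    intro w'
    obtain ⟨w, rfl⟩ := hsurj w'
    have h4 := h3 w
    rw [hD, hD, hgh.self_of_nhds, hsnd w v,
      hsymm (fderiv ℝ (fderiv ℝ φ) x v w) (fderiv ℝ φ x v)] at h4
    simp only [Function.comp_apply, ← hx, map_add, add_apply]
    linarith

lemma coordGeodesicAt_const (g : E → E →L[ℝ] E →L[ℝ] ℝ) (x : E) (t : ℝ) :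
    CoordGeodesicAt g (fun _ => x) t := by
  refine ⟨Eventually.of_forall fun s => differentiableAt_const _, ?_, fun w => ?_⟩ <;> simp

end MetricCalculus

section Bilinear

variable {E : Type*} [NormedAddCommGroup E] [InnerProductSpace ℝ E]

lemma isInvertible_of_isCoercive [CompleteSpace E] {B : E →L[ℝ] E →L[ℝ] ℝ} (hB : IsCoercive B) :
    B.IsInvertible := by
  refine ⟨(hB.continuousLinearEquivOfBilin).trans
    (InnerProductSpace.toDual ℝ E).toContinuousLinearEquiv, ?_⟩
  ext v w
  simp

end Bilinear


/-! ### Smooth coordinates, and the metric read in them -/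

section Coordinates

variable {H : Type*} [NormedAddCommGroup H] [InnerProductSpace ℝ H]
  {X : Type*} [TopologicalSpace X] [ChartedSpace H X]

/-- A smooth local coordinate system of `X`. -/
structure IsCoord (c : OpenPartialHomeomorph X H) : Prop where
  smooth : ContMDiffOn 𝓘(ℝ, H) 𝓘(ℝ, H) ∞ c c.source
  smooth_symm : ContMDiffOn 𝓘(ℝ, H) 𝓘(ℝ, H) ∞ c.symm c.target

namespace IsCoord

variable {c : OpenPartialHomeomorph X H}

lemma of_mem_maximalAtlas (hc : c ∈ IsManifold.maximalAtlas 𝓘(ℝ, H) ∞ X) : IsCoord c :=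
  ⟨contMDiffOn_of_mem_maximalAtlas hc, contMDiffOn_symm_of_mem_maximalAtlas hc⟩

lemma contMDiffAt (hc : IsCoord c) {p : X} (hp : p ∈ c.source) :
    ContMDiffAt 𝓘(ℝ, H) 𝓘(ℝ, H) ∞ c p :=
  hc.smooth.contMDiffAt (c.open_source.mem_nhds hp)

lemma contMDiffAt_symm (hc : IsCoord c) {x : H} (hx : x ∈ c.target) :
    ContMDiffAt 𝓘(ℝ, H) 𝓘(ℝ, H) ∞ c.symm x :=
  hc.smooth_symm.contMDiffAt (c.open_target.mem_nhds hx)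

lemma mdifferentiableAt (hc : IsCoord c) {p : X} (hp : p ∈ c.source) :
    MDifferentiableAt 𝓘(ℝ, H) 𝓘(ℝ, H) c p :=
  (hc.contMDiffAt hp).mdifferentiableAt (by simp)

lemma mdifferentiableAt_symm (hc : IsCoord c) {x : H} (hx : x ∈ c.target) :
    MDifferentiableAt 𝓘(ℝ, H) 𝓘(ℝ, H) c.symm x :=
  (hc.contMDiffAt_symm hx).mdifferentiableAt (by simp)

lemma mfderiv_mfderiv_symm (hc : IsCoord c) {x : H} (hx : x ∈ c.target)
    (v : TangentSpace 𝓘(ℝ, H) x) :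
    mfderiv 𝓘(ℝ, H) 𝓘(ℝ, H) c (c.symm x) (mfderiv 𝓘(ℝ, H) 𝓘(ℝ, H) c.symm x v) = v := by
  have h1 := mfderiv_comp x (hc.mdifferentiableAt (c.map_target hx)) (hc.mdifferentiableAt_symm hx)
  have h2 : (c ∘ c.symm) =ᶠ[𝓝 x] id := by
    filter_upwards [c.open_target.mem_nhds hx] with y hy using c.right_inv hy
  rw [h2.mfderiv_eq, mfderiv_id] at h1
  exact (congrArg (fun L : H →L[ℝ] H => L v) h1).symm

lemma mfderiv_symm_mfderiv (hc : IsCoord c) {p : X} (hp : p ∈ c.source)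
    (v : TangentSpace 𝓘(ℝ, H) p) :
    mfderiv 𝓘(ℝ, H) 𝓘(ℝ, H) c.symm (c p) (mfderiv 𝓘(ℝ, H) 𝓘(ℝ, H) c p v) = v := by
  have h1 := mfderiv_comp p (hc.mdifferentiableAt_symm (c.map_source hp)) (hc.mdifferentiableAt hp)
  have h2 : (c.symm ∘ c) =ᶠ[𝓝 p] id := by
    filter_upwards [c.open_source.mem_nhds hp] with y hy using c.left_inv hy
  rw [h2.mfderiv_eq, mfderiv_id] at h1
  exact (congrArg (fun L : H →L[ℝ] H => L v) h1).symm

end IsCoord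

lemma IsCoord.contDiffAt_transition {c c' : OpenPartialHomeomorph X H}
    (hc : IsCoord c) (hc' : IsCoord c') {p : X} (hp : p ∈ c.source) (hp' : p ∈ c'.source) :
    ContDiffAt ℝ ∞ (c' ∘ c.symm) (c p) := by
  rw [← contMDiffAt_iff_contDiffAt]
  exact ContMDiffAt.comp (c p) (by rw [c.left_inv hp]; exact hc'.contMDiffAt hp')
    (hc.contMDiffAt_symm (c.map_source hp))

lemma IsCoord.surjective_fderiv_transition {c c' : OpenPartialHomeomorph X H}
    (hc : IsCoord c) (hc' : IsCoord c') {p : X} (hp : p ∈ c.source) (hp' : p ∈ c'.source) :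
    Function.Surjective (fderiv ℝ (c' ∘ c.symm) (c p)) := by
  have h1 := (hc.contDiffAt_transition hc' hp hp').differentiableAt (by simp)
  have h2 := (hc'.contDiffAt_transition hc hp' hp).differentiableAt (by simp)
  have e : (c' ∘ c.symm) (c p) = c' p := by simp [c.left_inv hp]
  have e' : (c ∘ c'.symm) (c' p) = c p := by simp [c'.left_inv hp']
  have h3 : HasFDerivAt ((c' ∘ c.symm) ∘ (c ∘ c'.symm)) _ (c' p) :=
    HasFDerivAt.comp (c' p) (by rw [e']; exact h1.hasFDerivAt) h2.hasFDerivAt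
  have h4 : ((c' ∘ c.symm) ∘ (c ∘ c'.symm)) =ᶠ[𝓝 (c' p)] id := by
    have : ∀ᶠ x in 𝓝 (c' p), c'.symm x ∈ c.source :=
      (c'.continuousAt_symm (c'.map_source hp')).eventually_mem
        (c.open_source.mem_nhds (by rwa [c'.left_inv hp']))
    filter_upwards [this, c'.open_target.mem_nhds (c'.map_source hp')] with x hx hxt
    simp [c.left_inv hx, c'.right_inv hxt]
  have h5 := (h3.congr_of_eventuallyEq h4.symm).unique (hasFDerivAt_id _)
  intro v
  exact ⟨_, congrArg (fun L : H →L[ℝ] H => L v) h5⟩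

lemma hasDerivAt_coord {γ : ℝ → X} {t : ℝ} (hγ : MDifferentiableAt 𝓘(ℝ, ℝ) 𝓘(ℝ, H) γ t)
    {c : OpenPartialHomeomorph X H} (hc : IsCoord c) (ht : γ t ∈ c.source) :
    HasDerivAt (F := H) (c ∘ γ) (mfderiv 𝓘(ℝ, H) 𝓘(ℝ, H) c (γ t)
      (mfderiv 𝓘(ℝ, ℝ) 𝓘(ℝ, H) γ t (1 : ℝ))) t := by
  let A : H →L[ℝ] H := mfderiv 𝓘(ℝ, H) 𝓘(ℝ, H) c (γ t)
  let B : ℝ →L[ℝ] H := mfderiv 𝓘(ℝ, ℝ) 𝓘(ℝ, H) γ t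
  have h : HasFDerivAt (c ∘ γ) (A.comp B) t :=
    ((hc.mdifferentiableAt ht).hasMFDerivAt.comp t hγ.hasMFDerivAt).hasFDerivAt
  exact h.hasDerivAt

/-- The tangent vector of `X` with coordinates `q` (position and velocity) in the system `c`. -/
noncomputable def ofCoord (c : OpenPartialHomeomorph X H) (q : H × H) : TangentBundle 𝓘(ℝ, H) X :=
  ⟨c.symm q.1, mfderiv 𝓘(ℝ, H) 𝓘(ℝ, H) c.symm q.1 q.2⟩

lemma tangentMap_symm_comp {c : OpenPartialHomeomorph X H} (hc : IsCoord c) {u : ℝ → H} {u' : H}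
    (hu : HasDerivAt u u' 0) (h0 : u 0 ∈ c.target) :
    tangentMap 𝓘(ℝ, ℝ) 𝓘(ℝ, H) (fun t => c.symm (u t)) ⟨0, (1 : ℝ)⟩ = ofCoord c (u 0, u') := by
  have h2 := mfderiv_comp (I := 𝓘(ℝ, ℝ)) (I' := 𝓘(ℝ, H)) (I'' := 𝓘(ℝ, H)) (0 : ℝ)
    (f := u) (g := c.symm) (hc.mdifferentiableAt_symm h0) hu.differentiableAt.mdifferentiableAt
  have h3 : mfderiv 𝓘(ℝ, ℝ) 𝓘(ℝ, H) u 0 (1 : ℝ) = u' := by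
    rw [mfderiv_eq_fderiv]
    exact hu.deriv
  have h4 : mfderiv 𝓘(ℝ, ℝ) 𝓘(ℝ, H) (fun t => c.symm (u t)) 0 (1 : ℝ) =
      mfderiv 𝓘(ℝ, H) 𝓘(ℝ, H) c.symm (u 0) u' := by
    refine (congrArg (fun L : ℝ →L[ℝ] H => L 1) h2).trans ?_
    exact congrArg (mfderiv 𝓘(ℝ, H) 𝓘(ℝ, H) c.symm (u 0)) h3
  exact congrArg (TotalSpace.mk (c.symm (u 0))) h4

variable [IsManifold 𝓘(ℝ, H) ∞ X]

/-- The metric `g` read in the coordinate system `c`; meaningful on `c.target` only. -/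
noncomputable def chartMetric (g : StrongRiemannianMetric H X) (c : OpenPartialHomeomorph X H)
    (x : H) : H →L[ℝ] H →L[ℝ] ℝ :=
  ContinuousLinearMap.bilinearComp (E := H) (F := H) (g.inner (c.symm x))
    (mfderiv 𝓘(ℝ, H) 𝓘(ℝ, H) c.symm x : H →L[ℝ] H) (mfderiv 𝓘(ℝ, H) 𝓘(ℝ, H) c.symm x : H →L[ℝ] H)

lemma chartMetric_apply (g : StrongRiemannianMetric H X) (c : OpenPartialHomeomorph X H)
    (x v w : H) : chartMetric g c x v w =
      g.inner (c.symm x) (mfderiv 𝓘(ℝ, H) 𝓘(ℝ, H) c.symm x v)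
        (mfderiv 𝓘(ℝ, H) 𝓘(ℝ, H) c.symm x w) := rfl

lemma chartMetric_symm (g : StrongRiemannianMetric H X) (c : OpenPartialHomeomorph X H)
    (x v w : H) : chartMetric g c x v w = chartMetric g c x w v := by
  rw [chartMetric_apply, chartMetric_apply]
  exact g.symm (c.symm x) _ _

lemma contDiffAt_chartMetric (g : StrongRiemannianMetric H X) {c : OpenPartialHomeomorph X H}
    (hc : IsCoord c) {x : H} (hx : x ∈ c.target) : ContDiffAt ℝ ∞ (chartMetric g c) x := by
  set p := c.symm x with hp
  have h1 := (contMDiffAt_hom_bundle _).1 (g.contMDiff p)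
  have h2 := h1.2
  have h3 := (hc.contMDiffAt_symm hx).mfderiv_const (m := ∞) (by simp)
  set e := trivializationAt H (TangentSpace 𝓘(ℝ, H) : X → Type _) p with he
  -- the metric and the derivative of `c.symm`, both read in the trivialization `e`
  let G : X → (H →L[ℝ] H →L[ℝ] ℝ) := fun q => ContinuousLinearMap.bilinearComp (E := H) (F := H)
    (g.inner q) (e.symmL ℝ q : H →L[ℝ] H) (e.symmL ℝ q : H →L[ℝ] H)
  let M : H → (H →L[ℝ] H) := fun y =>
    (e.continuousLinearMapAt ℝ (c.symm y) : H →L[ℝ] H).comp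
      (mfderiv 𝓘(ℝ, H) 𝓘(ℝ, H) c.symm y : H →L[ℝ] H)
  have hpe : p ∈ e.baseSet := mem_baseSet_trivializationAt H _ p
  have hG : ContMDiffAt 𝓘(ℝ, H) 𝓘(ℝ, H →L[ℝ] H →L[ℝ] ℝ) ∞ G p := by
    refine h2.congr_of_eventuallyEq ?_
    filter_upwards [e.open_baseSet.mem_nhds hpe] with q hq
    ext v w
    have := inCoordinates_apply_eq₂ (𝕜 := ℝ) (F₁ := H) (F₂ := H) (F₃ := ℝ)
      (E₁ := (TangentSpace 𝓘(ℝ, H) : X → Type _)) (E₂ := (TangentSpace 𝓘(ℝ, H) : X → Type _))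
      (E₃ := Bundle.Trivial X ℝ) (x₀ := p) (x := q) (ϕ := g.inner q) (v := v) (w := w)
      hq hq (mem_univ _)
    refine Eq.trans ?_ this.symm
    simp only [Bundle.Trivial.fiberBundle_trivializationAt',
      Trivial.linearMapAt_trivialization, LinearMap.id_coe, id]
    change g.inner q (e.symmL ℝ q v) (e.symmL ℝ q w) = g.inner q (e.symm q v) (e.symm q w)
    rw [e.symmL_apply hq, e.symmL_apply hq]
  have hM : ContMDiffAt 𝓘(ℝ, H) 𝓘(ℝ, H →L[ℝ] H) ∞ M x := by
    refine h3.congr_of_eventuallyEq ?_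
    filter_upwards with y
    ext v
    simp [inTangentCoordinates, ContinuousLinearMap.inCoordinates, M, he]
    rfl
  have hGc : ContDiffAt ℝ ∞ (fun y => G (c.symm y)) x :=
    contMDiffAt_iff_contDiffAt.1 (hG.comp x (hc.contMDiffAt_symm hx))
  have hM' : ContDiffAt ℝ ∞ M x := contMDiffAt_iff_contDiffAt.1 hM
  have key : chartMetric g c =ᶠ[𝓝 x] fun y =>
      ContinuousLinearMap.bilinearComp (G (c.symm y)) (M y) (M y) := by
    have : ∀ᶠ y in 𝓝 x, c.symm y ∈ e.baseSet :=
      (hc.contMDiffAt_symm hx).continuousAt.eventually_mem (e.open_baseSet.mem_nhds hpe)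
    filter_upwards [this] with y hy
    ext v w
    have hh : ∀ v : TangentSpace 𝓘(ℝ, H) (c.symm y),
        e.symmL ℝ (c.symm y) (e.continuousLinearMapAt ℝ (c.symm y) v) = v :=
      fun v => e.symmL_continuousLinearMapAt hy v
    change g.inner (c.symm y) (mfderiv 𝓘(ℝ, H) 𝓘(ℝ, H) c.symm y v)
        (mfderiv 𝓘(ℝ, H) 𝓘(ℝ, H) c.symm y w) = g.inner (c.symm y)
        (e.symmL ℝ (c.symm y) (e.continuousLinearMapAt ℝ (c.symm y)
          (mfderiv 𝓘(ℝ, H) 𝓘(ℝ, H) c.symm y v)))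
        (e.symmL ℝ (c.symm y) (e.continuousLinearMapAt ℝ (c.symm y)
          (mfderiv 𝓘(ℝ, H) 𝓘(ℝ, H) c.symm y w)))
    rw [hh, hh]
  refine ContDiffAt.congr_of_eventuallyEq ?_ key
  have h4 := (ContinuousLinearMap.flipₗᵢ ℝ H H ℝ).contDiff.contDiffAt.comp x (hGc.clm_comp hM')
  exact (ContinuousLinearMap.flipₗᵢ ℝ H H ℝ).contDiff.contDiffAt.comp x (h4.clm_comp hM')

/-- The norm of a strong metric is equivalent to the norm of the model space. -/
lemma isCoercive_chartMetric (g : StrongRiemannianMetric H X) {c : OpenPartialHomeomorph X H}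
    (hc : IsCoord c) {x : H} (hx : x ∈ c.target) : IsCoercive (chartMetric g c x) := by
  have hb := g.isVonNBounded (c.symm x)
  have hb' : Bornology.IsVonNBounded ℝ {v : H | chartMetric g c x v v < 1} := by
    have := hb.image (mfderiv 𝓘(ℝ, H) 𝓘(ℝ, H) c (c.symm x))
    refine Bornology.IsVonNBounded.subset ?_ this
    intro v hv
    exact ⟨mfderiv 𝓘(ℝ, H) 𝓘(ℝ, H) c.symm x v, hv, hc.mfderiv_mfderiv_symm hx v⟩
  obtain ⟨R, hR0, hR⟩ := (NormedSpace.isVonNBounded_iff ℝ).1 hb' |>.exists_pos_norm_le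
  have hpos : ∀ v, v ≠ 0 → 0 < chartMetric g c x v v := by
    intro v hv
    refine g.pos (c.symm x) _ fun h0 => hv ?_
    have := hc.mfderiv_mfderiv_symm hx v
    exact this.symm.trans ((congrArg _ h0).trans (map_zero _))
  -- scaling: a vector `v` with `‖v‖ > R` has `g v v ≥ 1`
  refine ⟨1 / (2 * R) ^ 2, by positivity, fun v => ?_⟩
  rcases eq_or_ne v 0 with rfl | hv
  · simp
  have hv0 : 0 < ‖v‖ := norm_pos_iff.2 hv
  by_contra hlt
  push Not at hlt
  have hs : (2 * R / ‖v‖) • v ∈ {v : H | chartMetric g c x v v < 1} := by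
    simp only [mem_ofPred_eq, map_smul, smul_apply, smul_eq_mul]
    calc 2 * R / ‖v‖ * (2 * R / ‖v‖ * chartMetric g c x v v)
        < 2 * R / ‖v‖ * (2 * R / ‖v‖ * (1 / (2 * R) ^ 2 * ‖v‖ * ‖v‖)) := by gcongr
      _ = 1 := by field_simp
  have := hR _ hs
  rw [norm_smul, Real.norm_of_nonneg (by positivity), div_mul_cancel₀ _ hv0.ne'] at this
  linarith

lemma isInvertible_chartMetric [CompleteSpace H] (g : StrongRiemannianMetric H X)
    {c : OpenPartialHomeomorph X H} (hc : IsCoord c) {x : H} (hx : x ∈ c.target) :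
    (chartMetric g c x).IsInvertible :=
  isInvertible_of_isCoercive (isCoercive_chartMetric g hc hx)

/-- Change of coordinates for the metric. -/
lemma eventually_chartMetric_eq (g : StrongRiemannianMetric H X) {c c' : OpenPartialHomeomorph X H}
    (hc : IsCoord c) (hc' : IsCoord c') {p : X} (hp : p ∈ c.source) (hp' : p ∈ c'.source) :
    ∀ᶠ x in 𝓝 (c p), ∀ v w, chartMetric g c x v w =
      chartMetric g c' (c' (c.symm x)) (fderiv ℝ (c' ∘ c.symm) x v)
        (fderiv ℝ (c' ∘ c.symm) x w) := by
  have h1 : ∀ᶠ x in 𝓝 (c p), c.symm x ∈ c'.source :=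
    (c.continuousAt_symm (c.map_source hp)).eventually_mem
      (c'.open_source.mem_nhds (by rwa [c.left_inv hp]))
  filter_upwards [h1, c.open_target.mem_nhds (c.map_source hp)] with x hx hxt v w
  have h2 : fderiv ℝ (c' ∘ c.symm) x = (mfderiv 𝓘(ℝ, H) 𝓘(ℝ, H) c' (c.symm x)).comp
      (mfderiv 𝓘(ℝ, H) 𝓘(ℝ, H) c.symm x) := by
    rw [← mfderiv_eq_fderiv]
    exact mfderiv_comp x (hc'.mdifferentiableAt hx) (hc.mdifferentiableAt_symm hxt)
  have h3 : ∀ v, mfderiv 𝓘(ℝ, H) 𝓘(ℝ, H) c'.symm (c' (c.symm x)) (fderiv ℝ (c' ∘ c.symm) x v) =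
      mfderiv 𝓘(ℝ, H) 𝓘(ℝ, H) c.symm x v := by
    intro v
    rw [h2]
    exact hc'.mfderiv_symm_mfderiv hx _
  rw [chartMetric_apply, chartMetric_apply, h3, h3]
  have : ∀ q, q = c.symm x → g.inner (c.symm x) (mfderiv 𝓘(ℝ, H) 𝓘(ℝ, H) c.symm x v)
      (mfderiv 𝓘(ℝ, H) 𝓘(ℝ, H) c.symm x w) = g.inner q (mfderiv 𝓘(ℝ, H) 𝓘(ℝ, H) c.symm x v)
      (mfderiv 𝓘(ℝ, H) 𝓘(ℝ, H) c.symm x w) := by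
    rintro q rfl; rfl
  exact this _ (c'.left_inv hx)

/-- `γ` is a geodesic at time `t`: it satisfies the geodesic equation in some coordinate system. -/
def GeodesicAt (g : StrongRiemannianMetric H X) (γ : ℝ → X) (t : ℝ) : Prop :=
  ContinuousAt γ t ∧ ∃ c : OpenPartialHomeomorph X H, IsCoord c ∧ γ t ∈ c.source ∧
    CoordGeodesicAt (chartMetric g c) (c ∘ γ) t

/-- A geodesic satisfies the geodesic equation in every coordinate system. -/
lemma GeodesicAt.coord {g : StrongRiemannianMetric H X} {γ : ℝ → X} {t : ℝ}
    (h : GeodesicAt g γ t) {c : OpenPartialHomeomorph X H} (hc : IsCoord c) (hγ : γ t ∈ c.source) :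
    CoordGeodesicAt (chartMetric g c) (c ∘ γ) t := by
  obtain ⟨hcont, c', hc', hγ', h'⟩ := h
  have h1 := h'.comp (φ := c ∘ c'.symm) (h := chartMetric g c)
    ((hc'.contDiffAt_transition hc hγ' hγ).of_le (by norm_cast))
    ((contDiffAt_chartMetric g hc' (c'.map_source hγ')).differentiableAt (by simp))
    (by
      have := (contDiffAt_chartMetric g hc (c.map_source hγ)).differentiableAt (by simp)
      simpa [c'.left_inv hγ'] using this)
    (fun v w => chartMetric_symm g c _ v w)
    (eventually_chartMetric_eq g hc' hc hγ' hγ)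
    (hc'.surjective_fderiv_transition hc hγ' hγ)
  refine h1.congr ?_
  filter_upwards [hcont.eventually_mem (c'.open_source.mem_nhds hγ')] with s hs
  simp [c'.left_inv hs]

end Coordinates

/-! ### Geodesics and the exponential map -/

section Geodesics

variable {H : Type*} [NormedAddCommGroup H] [InnerProductSpace ℝ H]
  {X : Type*} [TopologicalSpace X] [ChartedSpace H X] [IsManifold 𝓘(ℝ, H) ∞ X]
  {g : StrongRiemannianMetric H X}

lemma GeodesicAt.mdifferentiableAt {γ : ℝ → X} {t : ℝ} (h : GeodesicAt g γ t) :
    MDifferentiableAt 𝓘(ℝ, ℝ) 𝓘(ℝ, H) γ t := by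
  obtain ⟨hcont, c, hc, hγ, h1, -⟩ := h
  have h2 : MDifferentiableAt 𝓘(ℝ, ℝ) 𝓘(ℝ, H) (c.symm ∘ (c ∘ γ)) t :=
    (hc.mdifferentiableAt_symm (c.map_source hγ)).comp t h1.self_of_nhds.mdifferentiableAt
  refine h2.congr_of_eventuallyEq ?_
  filter_upwards [hcont.eventually_mem (c.open_source.mem_nhds hγ)] with s hs
  simp [c.left_inv hs]

/-- Two geodesics with the same position and velocity agree locally. -/
lemma GeodesicAt.eventuallyEq [CompleteSpace H] {γ₁ γ₂ : ℝ → X} {t : ℝ}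
    (h₁ : ∀ᶠ s in 𝓝 t, GeodesicAt g γ₁ s) (h₂ : ∀ᶠ s in 𝓝 t, GeodesicAt g γ₂ s)
    {c : OpenPartialHomeomorph X H} (hc : IsCoord c) (ht : γ₁ t ∈ c.source) (he : γ₁ t = γ₂ t)
    (hd : deriv (c ∘ γ₁) t = deriv (c ∘ γ₂) t) : γ₁ =ᶠ[𝓝 t] γ₂ := by
  have key : ∀ γ : ℝ → X, (∀ᶠ s in 𝓝 t, GeodesicAt g γ s) → γ t ∈ c.source →
      (∀ᶠ s in 𝓝 t, γ s ∈ c.source) ∧ ∀ᶠ s in 𝓝 t,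
        HasDerivAt (fun s => ((c ∘ γ) s, deriv (c ∘ γ) s))
          (sprayField (spray (chartMetric g c)) ((c ∘ γ) s, deriv (c ∘ γ) s)) s := by
    intro γ h ht
    have hs : ∀ᶠ s in 𝓝 t, γ s ∈ c.source :=
      h.self_of_nhds.1.eventually_mem (c.open_source.mem_nhds ht)
    refine ⟨hs, ?_⟩
    filter_upwards [h, hs] with s hs1 hs2
    exact (hs1.coord hc hs2).hasDerivAt (isInvertible_chartMetric g hc (c.map_source hs2))
  obtain ⟨s₁, d₁⟩ := key γ₁ h₁ ht
  obtain ⟨s₂, d₂⟩ := key γ₂ h₂ (he ▸ ht)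
  have hx : c (γ₁ t) ∈ c.target := c.map_source ht
  have hu := sprayField_unique (q := (c (γ₁ t), deriv (c ∘ γ₁) t))
    (contDiffAt_spray (contDiffAt_chartMetric g hc hx) (isInvertible_chartMetric g hc hx)) d₁ d₂ rfl
    (by simp [he, hd])
  filter_upwards [hu, s₁, s₂] with s hs hs1 hs2
  exact c.injOn hs1 hs2 (congrArg Prod.fst hs)

/-- `γ` is a geodesic on `(-1, 2)` with initial velocity `p`. This open interval contains the times
`0` and `1` that enter the exponential map; nothing is required of `γ` outside of it. -/
def IsGeodesicFrom (g : StrongRiemannianMetric H X) (γ : ℝ → X) (p : TangentBundle 𝓘(ℝ, H) X) :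
    Prop :=
  (∀ t ∈ Ioo (-1 : ℝ) 2, GeodesicAt g γ t) ∧ tangentMap 𝓘(ℝ, ℝ) 𝓘(ℝ, H) γ ⟨0, (1 : ℝ)⟩ = p

lemma IsGeodesicFrom.unique [CompleteSpace H] [T2Space X] {γ₁ γ₂ : ℝ → X}
    {p : TangentBundle 𝓘(ℝ, H) X}
    (h₁ : IsGeodesicFrom g γ₁ p) (h₂ : IsGeodesicFrom g γ₂ p) : γ₁ 1 = γ₂ 1 := by
  have ev₁ : ∀ t ∈ Ioo (-1 : ℝ) 2, ∀ᶠ s in 𝓝 t, GeodesicAt g γ₁ s := fun t ht => by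
    filter_upwards [isOpen_Ioo.mem_nhds ht] with s hs using h₁.1 s hs
  have ev₂ : ∀ t ∈ Ioo (-1 : ℝ) 2, ∀ᶠ s in 𝓝 t, GeodesicAt g γ₂ s := fun t ht => by
    filter_upwards [isOpen_Ioo.mem_nhds ht] with s hs using h₂.1 s hs
  -- the open set of times around which the geodesics agree is relatively closed in `(-1, 2)`
  have hsub : Ioo (-1 : ℝ) 2 ⊆ {t | γ₁ =ᶠ[𝓝 t] γ₂} := by
    refine isPreconnected_Ioo.subset_of_closure_inter_subset isOpen_setOfPred_eventually_nhds
      ⟨0, by norm_num, ?_⟩ ?_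
    · have h0 : (0 : ℝ) ∈ Ioo (-1 : ℝ) 2 := by norm_num
      obtain ⟨-, c, hc, hc0, -⟩ := h₁.1 0 h0
      have e : (⟨γ₁ 0, mfderiv 𝓘(ℝ, ℝ) 𝓘(ℝ, H) γ₁ 0 (1 : ℝ)⟩ : TangentBundle 𝓘(ℝ, H) X) =
        ⟨γ₂ 0, mfderiv 𝓘(ℝ, ℝ) 𝓘(ℝ, H) γ₂ 0 (1 : ℝ)⟩ := h₁.2.trans h₂.2.symm
      have e0 : γ₁ 0 = γ₂ 0 := congrArg TotalSpace.proj e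
      refine GeodesicAt.eventuallyEq (ev₁ 0 h0) (ev₂ 0 h0) hc hc0 e0 ?_
      rw [(hasDerivAt_coord (h₁.1 0 h0).mdifferentiableAt hc hc0).deriv,
        (hasDerivAt_coord (h₂.1 0 h0).mdifferentiableAt hc (e0 ▸ hc0)).deriv]
      exact congrArg (fun q : TangentBundle 𝓘(ℝ, H) X =>
        (mfderiv 𝓘(ℝ, H) 𝓘(ℝ, H) c q.proj q.2 : H)) e
    · rintro t ⟨htc, ht⟩
      have hfr : ∃ᶠ s in 𝓝 t, γ₁ =ᶠ[𝓝 s] γ₂ := mem_closure_iff_frequently.1 htc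
      have e : γ₁ t = γ₂ t := tendsto_nhds_unique_of_frequently_eq (h₁.1 t ht).1 (h₂.1 t ht).1
        (hfr.mono fun s hs => hs.eq_of_nhds)
      obtain ⟨-, c, hc, hct, -⟩ := h₁.1 t ht
      refine GeodesicAt.eventuallyEq (ev₁ t ht) (ev₂ t ht) hc hct e ?_
      refine tendsto_nhds_unique_of_frequently_eq
        ((h₁.1 t ht).coord hc hct).2.1.continuousAt
        ((h₂.1 t ht).coord hc (e ▸ hct)).2.1.continuousAt (hfr.mono fun s hs => ?_)
      exact (hs.fun_comp c).deriv_eq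
  exact (hsub (show (1 : ℝ) ∈ Ioo (-1 : ℝ) 2 by norm_num)).eq_of_nhds

/-- The domain of the exponential map. -/
def expDomain (g : StrongRiemannianMetric H X) : Set (TangentBundle 𝓘(ℝ, H) X) :=
  {p | ∃ γ, IsGeodesicFrom g γ p}

open Classical in
/-- The exponential map: the position at time `1` of the geodesic with initial velocity `p`. Outside
of `expDomain g` the value is the base point of `p`, without meaning. -/
noncomputable def expMap (g : StrongRiemannianMetric H X) (p : TangentBundle 𝓘(ℝ, H) X) : X :=
  if h : ∃ γ, IsGeodesicFrom g γ p then h.choose 1 else p.proj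

lemma IsGeodesicFrom.expMap_eq [CompleteSpace H] [T2Space X] {γ : ℝ → X}
    {p : TangentBundle 𝓘(ℝ, H) X} (h : IsGeodesicFrom g γ p) : expMap g p = γ 1 := by
  have hex : ∃ γ, IsGeodesicFrom g γ p := ⟨γ, h⟩
  rw [expMap, dif_pos hex]
  exact hex.choose_spec.unique h

lemma isGeodesicFrom_const (y : X) :
    IsGeodesicFrom g (fun _ => y) (⟨y, 0⟩ : TangentBundle 𝓘(ℝ, H) X) := by
  refine ⟨fun t _ => ⟨continuousAt_const, chartAt H y,
    IsCoord.of_mem_maximalAtlas (IsManifold.chart_mem_maximalAtlas y), mem_chart_source H y,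
    coordGeodesicAt_const _ _ _⟩, ?_⟩
  simp only [tangentMap, mfderiv_const]
  rfl

lemma expMap_zero [CompleteSpace H] [T2Space X] (y : X) :
    expMap g (⟨y, 0⟩ : TangentBundle 𝓘(ℝ, H) X) = y :=
  (isGeodesicFrom_const y).expMap_eq

/-! ### Equivariance of the exponential map -/

section Equivariance

variable {G : Type*} [Group G] [MulAction G X]

/-- Each element of a group acting by isometries is a homeomorphism. -/
def ActsByIsometries.homeomorph (hG : ActsByIsometries G g) (a : G) : X ≃ₜ X where
  toEquiv := MulAction.toPerm a
  continuous_toFun := (hG.smooth a).continuous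
  continuous_invFun := (hG.smooth a⁻¹).continuous

/-- The coordinate system `c`, transported by the action of `a`. -/
def ActsByIsometries.coord (hG : ActsByIsometries G g) (a : G) (c : OpenPartialHomeomorph X H) :
    OpenPartialHomeomorph X H :=
  (hG.homeomorph a).symm.transOpenPartialHomeomorph c

lemma ActsByIsometries.isCoord (hG : ActsByIsometries G g) (a : G)
    {c : OpenPartialHomeomorph X H} (hc : IsCoord c) : IsCoord (hG.coord a c) where
  smooth := hc.smooth.comp (hG.smooth a⁻¹).contMDiffOn subset_rfl
  smooth_symm := (hG.smooth a).comp_contMDiffOn hc.smooth_symm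

lemma ActsByIsometries.chartMetric_coord (hG : ActsByIsometries G g) (a : G)
    {c : OpenPartialHomeomorph X H} (hc : IsCoord c) {x : H} (hx : x ∈ c.target) :
    chartMetric g (hG.coord a c) x = chartMetric g c x := by
  have h : mfderiv 𝓘(ℝ, H) 𝓘(ℝ, H) (hG.coord a c).symm x =
      (mfderiv 𝓘(ℝ, H) 𝓘(ℝ, H) (fun z : X => a • z) (c.symm x)).comp
        (mfderiv 𝓘(ℝ, H) 𝓘(ℝ, H) c.symm x) :=
    mfderiv_comp x ((hG.smooth a).mdifferentiableAt (by simp)) (hc.mdifferentiableAt_symm hx)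
  ext v w
  rw [chartMetric_apply, chartMetric_apply, h]
  exact hG.isometry a (c.symm x) _ _

lemma GeodesicAt.smul (hG : ActsByIsometries G g) (a : G) {γ : ℝ → X} {t : ℝ}
    (h : GeodesicAt g γ t) : GeodesicAt g (fun s => a • γ s) t := by
  obtain ⟨hcont, c, hc, hγ, h1, h2, h3⟩ := h
  have e : (hG.coord a c) ∘ (fun s => a • γ s) = c ∘ γ := by
    ext s
    change c (a⁻¹ • a • γ s) = c (γ s)
    rw [inv_smul_smul]
  refine ⟨(hG.smooth a).continuous.continuousAt.comp hcont, hG.coord a c, hG.isCoord a hc, ?_, ?_⟩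
  · change a⁻¹ • a • γ t ∈ c.source
    rwa [inv_smul_smul]
  · have he : chartMetric g (hG.coord a c) =ᶠ[𝓝 (c (γ t))] chartMetric g c := by
      filter_upwards [c.open_target.mem_nhds (c.map_source hγ)] with x hx
      exact hG.chartMetric_coord a hc hx
    rw [e]
    refine ⟨h1, h2, fun w => ?_⟩
    have h4 := h3 w
    rw [Function.comp_apply] at h4 ⊢
    rw [he.eq_of_nhds, he.fderiv_eq]
    exact h4

lemma IsGeodesicFrom.smul (hG : ActsByIsometries G g) (a : G) {γ : ℝ → X}
    {p : TangentBundle 𝓘(ℝ, H) X} (h : IsGeodesicFrom g γ p) :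
    IsGeodesicFrom g (fun s => a • γ s) (tangentAct a p) := by
  refine ⟨fun t ht => (h.1 t ht).smul hG a, ?_⟩
  have := tangentMap_comp_at (I := 𝓘(ℝ, ℝ)) (I' := 𝓘(ℝ, H)) (I'' := 𝓘(ℝ, H))
    (f := γ) (g := fun x : X => a • x) ⟨0, (1 : ℝ)⟩
    ((hG.smooth a).mdifferentiableAt (by simp)) (h.1 0 (by norm_num)).mdifferentiableAt
  rw [tangentAct, ← h.2]
  exact this

lemma tangentAct_mem_expDomain (hG : ActsByIsometries G g) (a : G) {p : TangentBundle 𝓘(ℝ, H) X}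
    (hp : p ∈ expDomain g) : tangentAct a p ∈ expDomain g :=
  let ⟨_, h⟩ := hp
  ⟨_, h.smul hG a⟩

lemma expMap_tangentAct [CompleteSpace H] [T2Space X] (hG : ActsByIsometries G g) (a : G)
    {p : TangentBundle 𝓘(ℝ, H) X} (hp : p ∈ expDomain g) :
    expMap g (tangentAct a p) = a • expMap g p := by
  obtain ⟨γ, h⟩ := hp
  rw [h.expMap_eq, (h.smul hG a).expMap_eq]

end Equivariance

/-- A solution of the spray equation in coordinates is a geodesic. -/
lemma isGeodesicFrom_of_solution [CompleteSpace H] {c : OpenPartialHomeomorph X H} (hc : IsCoord c)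
    {p : ℝ → H × H} (hp : ∀ t ∈ Ioo (-1 : ℝ) 2, (p t).1 ∈ c.target ∧
      HasDerivAt p (sprayField (spray (chartMetric g c)) (p t)) t) :
    IsGeodesicFrom g (fun t => c.symm (p t).1) (ofCoord c (p 0)) := by
  constructor
  · intro t ht
    have hc1 : ContinuousAt (fun s => (p s).1) t := (hp t ht).2.continuousAt.fst
    have ht1 := (hp t ht).1
    refine ⟨ContinuousAt.comp (f := fun s => (p s).1) (c.continuousAt_symm ht1) hc1, c, hc,
      c.map_target ht1, ?_⟩
    have h1 := coordGeodesicAt_of_hasDerivAt (g := chartMetric g c) (p := p) (t := t)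
      (by filter_upwards [isOpen_Ioo.mem_nhds ht] with s hs using (hp s hs).2)
      (isInvertible_chartMetric g hc ht1)
    refine h1.congr ?_
    filter_upwards [hc1.eventually_mem (c.open_target.mem_nhds ht1)] with s hs
    exact c.right_inv hs
  · have h0 := hp 0 (by norm_num)
    have hd := h0.2.prod_fst
    exact tangentMap_symm_comp hc hd h0.1

/-- Close to the zero section, the exponential map is defined and stays in the domain of
coordinates. -/
lemma eventually_ofCoord_mem_expDomain [CompleteSpace H] [T2Space X]
    {c : OpenPartialHomeomorph X H} (hc : IsCoord c) {x : H} (hx : x ∈ c.target) :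
    ∀ᶠ q in 𝓝 (x, (0 : H)), ofCoord c q ∈ expDomain g ∧ expMap g (ofCoord c q) ∈ c.source := by
  have hΓ := contDiffAt_spray (v := 0) (contDiffAt_chartMetric g hc hx)
    (isInvertible_chartMetric g hc hx)
  have hU : Prod.fst ⁻¹' c.target ∈ 𝓝 (x, (0 : H)) :=
    continuousAt_fst.preimage_mem_nhds (c.open_target.mem_nhds hx)
  filter_upwards [exists_solution_near hΓ (spray_smul _) hU] with q hq
  obtain ⟨p, hp0, hp⟩ := hq
  have h := isGeodesicFrom_of_solution (g := g) hc hp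
  rw [hp0] at h
  refine ⟨⟨_, h⟩, ?_⟩
  rw [h.expMap_eq]
  exact c.map_target (hp 1 (by norm_num)).1

/-- In coordinates, the exponential map is strictly differentiable at a zero vector, with
derivative `(x, v) ↦ x + v`. -/
lemma hasStrictFDerivAt_expMap [CompleteSpace H] [T2Space X]
    {c : OpenPartialHomeomorph X H} (hc : IsCoord c) {x : H} (hx : x ∈ c.target) :
    HasStrictFDerivAt (fun q => c (expMap g (ofCoord c q)))
      (ContinuousLinearMap.fst ℝ H H + ContinuousLinearMap.snd ℝ H H) (x, (0 : H)) := by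
  have hΓ := contDiffAt_spray (v := 0) (contDiffAt_chartMetric g hc hx)
    (isInvertible_chartMetric g hc hx)
  have hT : Prod.fst ⁻¹' c.target ∈ 𝓝 (x, (0 : H)) :=
    continuousAt_fst.preimage_mem_nhds (c.open_target.mem_nhds hx)
  rw [hasStrictFDerivAt_iff_isLittleO, Asymptotics.isLittleO_iff]
  intro κ hκ
  obtain ⟨U, hU, hest⟩ := norm_solution_sub_le hΓ (spray_smul _) hκ
  have h1 := exists_solution_near hΓ (spray_smul _) (inter_mem hU hT)
  filter_upwards [h1.prod_nhds h1] with q hq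
  obtain ⟨⟨p₁, h01, hp₁⟩, ⟨p₂, h02, hp₂⟩⟩ := hq
  have hI : Icc (0 : ℝ) 1 ⊆ Ioo (-1) 2 := Icc_subset_Ioo (by norm_num) (by norm_num)
  have key : ∀ (p : ℝ → H × H) (q : H × H), p 0 = q → (∀ t ∈ Ioo (-1 : ℝ) 2,
      p t ∈ U ∩ Prod.fst ⁻¹' c.target ∧
        HasDerivAt p (sprayField (spray (chartMetric g c)) (p t)) t) →
      c (expMap g (ofCoord c q)) = (p 1).1 := by
    rintro p q rfl hp
    rw [(isGeodesicFrom_of_solution (g := g) hc fun t ht => ⟨(hp t ht).1.2, (hp t ht).2⟩).expMap_eq,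
      c.right_inv (hp 1 (by norm_num)).1.2]
  have := hest p₁ p₂ (fun t ht => ⟨(hp₁ t (hI ht)).1.1, (hp₁ t (hI ht)).2⟩)
    (fun t ht => ⟨(hp₂ t (hI ht)).1.1, (hp₂ t (hI ht)).2⟩)
  rw [key p₁ _ h01 hp₁, key p₂ _ h02 hp₂]
  rw [h01, h02] at this
  simpa using this

end Geodesics

/-! ### Tangent and normal vectors of a submanifold in a straightening chart -/

section Bilinear

variable {E : Type*} [NormedAddCommGroup E] [InnerProductSpace ℝ E]

/-- Orthogonal projection onto a closed subspace, for a coercive bilinear form. -/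
lemma exists_sub_orthogonal [CompleteSpace E] {B : E →L[ℝ] E →L[ℝ] ℝ} (hB : IsCoercive B)
    {F : Submodule ℝ E}
    (hF : IsClosed (F : Set E)) (h : E) : ∃ f ∈ F, ∀ w ∈ F, B (h - f) w = 0 := by
  have : CompleteSpace F := hF.completeSpace_coe
  have hBF : IsCoercive (B.bilinearComp F.subtypeL F.subtypeL) := by
    obtain ⟨C, hC, h⟩ := hB
    exact ⟨C, hC, fun u => h u⟩
  obtain ⟨e, he⟩ := isInvertible_of_isCoercive hBF
  set f := e.symm ((B h).comp F.subtypeL) with hf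
  refine ⟨f, f.2, fun w hw => ?_⟩
  have h1 : e f = (B h).comp F.subtypeL := by rw [hf, e.apply_symm_apply]
  have h2 := congrArg (fun L : F →L[ℝ] ℝ => L ⟨w, hw⟩) h1
  have h3 : e f ⟨w, hw⟩ = B f w := congrArg (fun L : F →L[ℝ] F →L[ℝ] ℝ => L f ⟨w, hw⟩) he
  have h4 : e f ⟨w, hw⟩ = B h w := h2
  rw [map_sub, sub_apply, ← h3, h4, sub_self]

lemma eq_zero_of_coercive {B : E →L[ℝ] E →L[ℝ] ℝ} (hB : IsCoercive B) {v : E} (hv : B v v = 0) :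
    v = 0 := by
  obtain ⟨C, hC, h⟩ := hB
  have := h v
  rw [hv] at this
  by_contra h0
  have : 0 < C * ‖v‖ * ‖v‖ := by have := norm_pos_iff.2 h0; positivity
  linarith

end Bilinear

section Adapted

variable {H : Type*} [NormedAddCommGroup H] [InnerProductSpace ℝ H]
  {X : Type*} [TopologicalSpace X] [ChartedSpace H X]
  {c : OpenPartialHomeomorph X H} {Y : Set X} {F : Submodule ℝ H}

lemma IsCoord.mfderiv_mfderiv_symm' (hc : IsCoord c) {p : X} (hp : p ∈ c.source) (v : H) :
    (mfderiv 𝓘(ℝ, H) 𝓘(ℝ, H) c p : H →L[ℝ] H) (mfderiv 𝓘(ℝ, H) 𝓘(ℝ, H) c.symm (c p) v) = v := by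
  have h1 : (mfderiv 𝓘(ℝ, H) 𝓘(ℝ, H) c (c.symm (c p)) : H →L[ℝ] H)
      (mfderiv 𝓘(ℝ, H) 𝓘(ℝ, H) c.symm (c p) v) = v := hc.mfderiv_mfderiv_symm (c.map_source hp) v
  rwa [c.left_inv hp] at h1

lemma ofCoord_apply (hp : (p : X) ∈ c.source) (v : H) :
    ofCoord c (c p, v) = ⟨p, mfderiv 𝓘(ℝ, H) 𝓘(ℝ, H) c.symm (c p) v⟩ := by
  have : ∀ q, q = p → (TotalSpace.mk q (mfderiv 𝓘(ℝ, H) 𝓘(ℝ, H) c.symm (c p) v : H) :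
      TangentBundle 𝓘(ℝ, H) X) = TotalSpace.mk p (mfderiv 𝓘(ℝ, H) 𝓘(ℝ, H) c.symm (c p) v : H) := by
    rintro q rfl; rfl
  exact this _ (c.left_inv hp)

lemma ofCoord_mfderiv (hc : IsCoord c) {p : TangentBundle 𝓘(ℝ, H) X} (hp : p.proj ∈ c.source) :
    ofCoord c (c p.proj, mfderiv 𝓘(ℝ, H) 𝓘(ℝ, H) c p.proj p.2) = p := by
  refine (ofCoord_apply hp _).trans ?_
  exact congrArg (TotalSpace.mk p.proj) (hc.mfderiv_symm_mfderiv hp p.2)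

/-- In a chart which straightens `Y` to `F`, tangent vectors of `Y` have coordinates in `F`. -/
lemma mfderiv_mem_of_mem_tangentSet (hc : IsCoord c) (hF : IsClosed (F : Set H))
    (hYF : ∀ x ∈ c.source, (x ∈ Y ↔ c x ∈ F)) {p : TangentBundle 𝓘(ℝ, H) X}
    (hp : p.proj ∈ c.source) (hpY : p ∈ tangentSet Y) :
    (mfderiv 𝓘(ℝ, H) 𝓘(ℝ, H) c p.proj p.2 : H) ∈ F := by
  obtain ⟨γ, hγ, hγY, rfl⟩ := hpY
  change γ 0 ∈ c.source at hp
  have hd := hasDerivAt_coord (hγ.mdifferentiableAt (by simp)) hc hp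
  have hmem : ∀ᶠ t in 𝓝 (0 : ℝ), (c ∘ γ) t ∈ F := by
    filter_upwards [hγY, hγ.continuousAt.eventually_mem (c.open_source.mem_nhds hp)] with t h1 h2
    exact (hYF _ h2).1 h1
  refine hF.mem_of_tendsto hd.tendsto_slope ?_
  filter_upwards [hmem.filter_mono nhdsWithin_le_nhds] with t ht
  exact F.smul_mem _ (F.sub_mem ht hmem.self_of_nhds)

/-- In a chart which straightens `Y` to `F`, all vectors of `F` are coordinates of tangent
vectors of `Y`. -/
lemma ofCoord_mem_tangentSet (hc : IsCoord c)
    (hYF : ∀ x ∈ c.source, (x ∈ Y ↔ c x ∈ F)) {x f : H} (hx : x ∈ c.target) (hxF : x ∈ F)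
    (hf : f ∈ F) : ofCoord c (x, f) ∈ tangentSet Y := by
  have hu : HasDerivAt (fun t : ℝ => x + t • f) f 0 := by
    simpa using ((hasDerivAt_id (0 : ℝ)).smul_const f).const_add x
  have hx' : x + (0 : ℝ) • f ∈ c.target := by simpa using hx
  have hcont : ContinuousAt (fun t : ℝ => x + t • f) 0 := hu.continuousAt
  refine ⟨fun t => c.symm (x + t • f), ?_, ?_, ?_⟩
  · refine ContMDiffAt.comp (0 : ℝ) (hc.contMDiffAt_symm hx') ?_
    rw [contMDiffAt_iff_contDiffAt]
    fun_prop
  · filter_upwards [hcont.eventually_mem (c.open_target.mem_nhds hx')] with t ht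
    rw [hYF _ (c.map_target ht), c.right_inv ht]
    exact F.add_mem hxF (F.smul_mem _ hf)
  · rw [tangentMap_symm_comp hc hu hx']
    simp

variable [IsManifold 𝓘(ℝ, H) ∞ X]

lemma chartMetric_mfderiv (g : StrongRiemannianMetric H X) (hc : IsCoord c) {p : X}
    (hp : p ∈ c.source) (v w : TangentSpace 𝓘(ℝ, H) p) :
    chartMetric g c (c p) (mfderiv 𝓘(ℝ, H) 𝓘(ℝ, H) c p v) (mfderiv 𝓘(ℝ, H) 𝓘(ℝ, H) c p w) =
      g.inner p v w := by
  have : ∀ q, q = p → ∀ v' w' : H, g.inner q v' w' = g.inner p v' w' := by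
    rintro q rfl v' w'; rfl
  refine (this _ (c.left_inv hp) _ _).trans ?_
  have h1 := hc.mfderiv_symm_mfderiv hp v
  have h2 := hc.mfderiv_symm_mfderiv hp w
  exact congrArg₂ (fun a b : TangentSpace 𝓘(ℝ, H) p => g.inner p a b) h1 h2

/-- In a chart which straightens `Y` to `F`, normal vectors are those whose coordinates are
orthogonal to `F`. -/
lemma mem_normalSet_iff (g : StrongRiemannianMetric H X) (hc : IsCoord c)
    (hF : IsClosed (F : Set H)) (hYF : ∀ x ∈ c.source, (x ∈ Y ↔ c x ∈ F))
    {p : TangentBundle 𝓘(ℝ, H) X} (hp : p.proj ∈ c.source) (hpY : p.proj ∈ Y) :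
    p ∈ normalSet g Y ↔
      ∀ f ∈ F, chartMetric g c (c p.proj) (mfderiv 𝓘(ℝ, H) 𝓘(ℝ, H) c p.proj p.2) f = 0 := by
  constructor
  · rintro ⟨-, h⟩ f hf
    have h1 := h (mfderiv 𝓘(ℝ, H) 𝓘(ℝ, H) c.symm (c p.proj) f) (by
      rw [← ofCoord_apply hp]
      exact ofCoord_mem_tangentSet hc hYF (c.map_source hp) ((hYF _ hp).1 hpY) hf)
    replace h1 := (chartMetric_mfderiv g hc hp p.2 _).trans h1
    have h2 := hc.mfderiv_mfderiv_symm' hp f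
    exact (congrArg (fun a : H => chartMetric g c (c p.proj)
      (mfderiv 𝓘(ℝ, H) 𝓘(ℝ, H) c p.proj p.2) a) h2).symm.trans h1
  · refine fun h => ⟨hpY, fun w hw => ?_⟩
    rw [← chartMetric_mfderiv g hc hp]
    exact h _ (mfderiv_mem_of_mem_tangentSet hc hF hYF
      (p := (⟨p.proj, w⟩ : TangentBundle 𝓘(ℝ, H) X)) hp hw)

end Adapted


/-! ### Coordinates of the tangent bundle given by a trivialization -/

section Parametrization

variable {H : Type*} [NormedAddCommGroup H] [InnerProductSpace ℝ H]
  {X : Type*} [TopologicalSpace X] [ChartedSpace H X]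

lemma contDiffAt_of_contMDiffAt_prod {f : H × H → H} {q : H × H}
    (hf : ContMDiffAt (𝓘(ℝ, H).prod 𝓘(ℝ, H)) 𝓘(ℝ, H) ∞ f q) : ContDiffAt ℝ ∞ f q := by
  rw [← contMDiffAt_iff_contDiffAt]
  rwa [modelWithCornersSelf_prod, ← chartedSpaceSelf_prod]

/-- The position and velocity of a tangent vector of `X` in the coordinate system `c`. -/
noncomputable def tangentCoord (c : OpenPartialHomeomorph X H) (p : TangentBundle 𝓘(ℝ, H) X) :
    H × H :=
  (c p.proj, mfderiv 𝓘(ℝ, H) 𝓘(ℝ, H) c p.proj p.2)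

variable [IsManifold 𝓘(ℝ, H) ∞ X]

/-- The tangent vector with base point of coordinate `q.1` in the system `c` and with fibre
coordinate `q.2` in the trivialization `e`. -/
noncomputable def trivVec (c : OpenPartialHomeomorph X H)
    (e : Trivialization H (TotalSpace.proj : TangentBundle 𝓘(ℝ, H) X → X)) (q : H × H) :
    TangentBundle 𝓘(ℝ, H) X :=
  e.toOpenPartialHomeomorph.symm (c.symm q.1, q.2)

variable {c : OpenPartialHomeomorph X H}
  {e : Trivialization H (TotalSpace.proj : TangentBundle 𝓘(ℝ, H) X → X)}

lemma trivVec_proj {q : H × H} (hq : c.symm q.1 ∈ e.baseSet) : (trivVec c e q).proj = c.symm q.1 :=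
  e.proj_symm_apply' hq

lemma trivVec_coord {p : TangentBundle 𝓘(ℝ, H) X} (hp : p.proj ∈ c.source)
    (hpe : p.proj ∈ e.baseSet) : trivVec c e (c p.proj, (e p).2) = p := by
  rw [trivVec, c.left_inv hp]
  exact e.symm_apply_mk_proj (e.mem_source.2 hpe)

lemma coord_trivVec {q : H × H} (hq : q.1 ∈ c.target) (hqe : c.symm q.1 ∈ e.baseSet) :
    c (trivVec c e q).proj = q.1 ∧ (e (trivVec c e q)).2 = q.2 := by
  refine ⟨by rw [trivVec_proj hqe, c.right_inv hq], ?_⟩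
  rw [trivVec, e.apply_symm_apply' hqe]

lemma tangentCoord_trivVec [e.IsLinear ℝ] {x k : H} (hx : x ∈ c.target)
    (hxe : c.symm x ∈ e.baseSet) : tangentCoord c (trivVec c e (x, k)) =
      (x, mfderiv 𝓘(ℝ, H) 𝓘(ℝ, H) c (c.symm x) (e.symmL ℝ (c.symm x) k)) := by
  rw [trivVec, ← e.mk_symm hxe, tangentCoord, e.symmL_apply hxe]
  simp [c.right_inv hx]
  rfl

lemma continuousOn_trivVec :
    ContinuousOn (trivVec c e) {q | q.1 ∈ c.target ∧ c.symm q.1 ∈ e.baseSet} := by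
  refine e.toOpenPartialHomeomorph.continuousOn_symm.comp (t := e.target) ?_ ?_
  · exact ((c.continuousOn_symm.comp continuousOn_fst fun q hq => hq.1)).prodMk continuousOn_snd
  · intro q hq
    exact e.mem_target.2 hq.2

lemma contDiffAt_tangentCoord_trivVec (hc : IsCoord c)
    (he : ContMDiffOn (𝓘(ℝ, H).prod 𝓘(ℝ, H)) 𝓘(ℝ, H).tangent ∞ e.toOpenPartialHomeomorph.symm
      e.target) {q : H × H} (hq : q.1 ∈ c.target) (hqe : c.symm q.1 ∈ e.baseSet) :
    ContDiffAt ℝ ∞ (fun q => tangentCoord c (trivVec c e q)) q := by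
  have h1 : ContMDiffAt (𝓘(ℝ, H).prod 𝓘(ℝ, H)) 𝓘(ℝ, H).tangent ∞ (trivVec c e) q := by
    refine ContMDiffAt.comp q (I' := 𝓘(ℝ, H).prod 𝓘(ℝ, H)) (g := e.toOpenPartialHomeomorph.symm)
      (f := fun q : H × H => (c.symm q.1, q.2))
      (he.contMDiffAt (e.open_target.mem_nhds (e.mem_target.2 hqe))) ?_
    exact ((hc.contMDiffAt_symm hq).comp q contMDiffAt_fst).prodMk contMDiffAt_snd
  have hopen : IsOpen (TotalSpace.proj ⁻¹' c.source : Set (TangentBundle 𝓘(ℝ, H) X)) :=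
    c.open_source.preimage (FiberBundle.continuous_proj H (TangentSpace 𝓘(ℝ, H)))
  have hmem : trivVec c e q ∈ (TotalSpace.proj ⁻¹' c.source : Set (TangentBundle 𝓘(ℝ, H) X)) := by
    rw [mem_preimage, trivVec_proj hqe]
    exact c.map_target hq
  have h2 := (hc.smooth.contMDiffOn_tangentMapWithin (m := ∞) (by simp)
    c.open_source.uniqueMDiffOn).contMDiffAt (hopen.mem_nhds hmem)
  have h3 := h2.comp q h1
  have h4 := contMDiffAt_totalSpace.1 h3
  have hev : ∀ᶠ q' in 𝓝 q, (trivVec c e q').proj ∈ c.source :=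
    h1.continuousAt.eventually_mem (hopen.mem_nhds hmem)
  have h5 := contDiffAt_of_contMDiffAt_prod h4.1
  have h6 := contDiffAt_of_contMDiffAt_prod h4.2
  refine (h5.prodMk h6).congr_of_eventuallyEq ?_
  filter_upwards [hev] with q' hq'
  have h7 : tangentMapWithin 𝓘(ℝ, H) 𝓘(ℝ, H) c c.source (trivVec c e q') =
      tangentMap 𝓘(ℝ, H) 𝓘(ℝ, H) c (trivVec c e q') := by
    rw [tangentMapWithin, tangentMap, mfderivWithin_of_isOpen c.open_source hq']
  simp only [Function.comp_apply, h7]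
  simp [tangentCoord, tangentMap]

end Parametrization


/-! ### Gluing local tubes with an invariant radius function -/

section Gluing

open scoped ENNReal NNReal

variable {X T : Type*} {D N S : Set T} {E : T → X}

/-- The map `E` embeds `S` as an open subset: it is injective and continuous on `S`, and images of
relatively open subsets of `S` are open in the whole of `X`. Moreover, `S` is contained in the set
`D` on which `E` is meaningful. -/
structure OpenEmbedsOn [TopologicalSpace X] [TopologicalSpace T] (E : T → X) (D S : Set T) :
    Prop where
  subset : S ⊆ D
  injOn : InjOn E S
  continuousOn : ContinuousOn E S
  isOpen_image (O : Set T) : IsOpen O → IsOpen (E '' (S ∩ O))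

lemma OpenEmbedsOn.inter [TopologicalSpace X] [TopologicalSpace T] (h : OpenEmbedsOn E D S)
    {O : Set T} (hO : IsOpen O) : OpenEmbedsOn E D (S ∩ O) where
  subset := inter_subset_left.trans h.subset
  injOn := h.injOn.mono inter_subset_left
  continuousOn := h.continuousOn.mono inter_subset_left
  isOpen_image O' hO' := by
    rw [inter_assoc]
    exact h.isOpen_image _ (hO.inter hO')

lemma OpenEmbedsOn.of_locally [TopologicalSpace X] [TopologicalSpace T] (hinj : InjOn E S)
    (h : ∀ p ∈ S, ∃ U, IsOpen U ∧ p ∈ U ∧ OpenEmbedsOn E D (S ∩ U)) : OpenEmbedsOn E D S where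
  subset p hp := by
    obtain ⟨U, -, hpU, hU⟩ := h p hp
    exact hU.subset ⟨hp, hpU⟩
  injOn := hinj
  continuousOn p hp := by
    obtain ⟨U, hUo, hpU, hU⟩ := h p hp
    exact (continuousWithinAt_inter (hUo.mem_nhds hpU)).1 (hU.continuousOn p ⟨hp, hpU⟩)
  isOpen_image O hO := by
    choose! U hUo hpU hU using h
    have : E '' (S ∩ O) = ⋃ p ∈ S, E '' ((S ∩ U p) ∩ O) := by
      ext x
      simp only [mem_image, mem_iUnion]
      constructor
      · rintro ⟨p, ⟨hp, hpO⟩, rfl⟩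
        exact ⟨p, hp, p, ⟨⟨hp, hpU p hp⟩, hpO⟩, rfl⟩
      · rintro ⟨-, -, p, ⟨⟨hp, -⟩, hpO⟩, rfl⟩
        exact ⟨p, ⟨hp, hpO⟩, rfl⟩
    rw [this]
    exact isOpen_biUnion fun p hp => (hU p hp).isOpen_image O hO

/-- A continuous family `pr : T → X` of spaces with a scalar multiplication over a metric space,
with zero section `z` and with a continuous fibre norm `n`, such that every neighbourhood of `z y`
contains all sufficiently short vectors over points sufficiently close to `y`. This is the part of
the structure of the tangent bundle which is used to adjust the size of a tubular neighbourhood. -/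
structure IsNormedBundle [PseudoEMetricSpace X] [TopologicalSpace T] [MulAction ℝ T]
    (pr : T → X) (n : T → ℝ≥0) (z : X → T) : Prop where
  continuous_proj : Continuous pr
  continuous_norm : Continuous n
  proj_smul (t : ℝ) (p : T) : pr (t • p) = pr p
  norm_smul (t : ℝ) (p : T) : n (t • p) = ‖t‖₊ * n p
  proj_zero (y : X) : pr (z y) = y
  smul_zero (t : ℝ) (y : X) : t • z y = z y
  exists_subset (y : X) (W : Set T) : IsOpen W → z y ∈ W →
    ∃ r : ℝ≥0∞, 0 < r ∧ {p | edist y (pr p) < r ∧ (n p : ℝ≥0∞) < r} ⊆ W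

variable [PseudoEMetricSpace X] {pr : T → X} {n : T → ℝ≥0} {z : X → T}

/-- The vectors in `N` of length less than `r` at points of distance less than `r` to `y`. -/
def tubeBall (pr : T → X) (n : T → ℝ≥0) (N : Set T) (y : X) (r : ℝ≥0∞) : Set T :=
  N ∩ {p | edist y (pr p) < r ∧ (n p : ℝ≥0∞) < r}

/-- The supremum of the radii, at most `1`, for which the property `Q` holds on the ball around `y`.
The bound makes it finite; it is a `1`-Lipschitz function of `y` if `Q` passes to open subsets. -/
noncomputable def tubeRadius (pr : T → X) (n : T → ℝ≥0) (N : Set T) (Q : Set T → Prop) (y : X) :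
    ℝ≥0∞ :=
  sSup {r | r ≤ 1 ∧ Q (tubeBall pr n N y r)}

variable {Q : Set T → Prop}

lemma tubeRadius_le_one (y : X) : tubeRadius pr n N Q y ≤ 1 :=
  sSup_le fun _ h => h.1

lemma tubeBall_subset {y y' : X} {r r' : ℝ≥0∞} (h : r' + edist y y' ≤ r) (hr : r ≠ ⊤) :
    tubeBall pr n N y' r' ⊆ tubeBall pr n N y r := by
  rintro p ⟨hp, h1, h2⟩
  have hy : edist y y' ≠ ⊤ := ne_top_of_le_ne_top hr (le_add_self.trans h)
  refine ⟨hp, ?_, h2.trans_le (le_self_add.trans h)⟩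
  calc edist y (pr p) ≤ edist y y' + edist y' (pr p) := edist_triangle _ _ _
    _ < edist y y' + r' := ENNReal.add_lt_add_left hy h1
    _ ≤ r := by rwa [add_comm]

section Group

variable {G : Type*} [Group G] [MulAction G X] [MulAction G T]

/-- The group `G` acts on the family `T → X` preserving the norm, the subset `N` and the domain `D`
of `E`, and `E` is equivariant on `D`. -/
structure IsEquivariantExp (G : Type*) [Group G] [MulAction G X] [MulAction G T] (pr : T → X)
    (n : T → ℝ≥0) (N D : Set T) (E : T → X) : Prop where
  proj_smul (a : G) (p : T) : pr (a • p) = a • pr p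
  norm_smul (a : G) (p : T) : n (a • p) = n p
  smul_mem (a : G) {p : T} : p ∈ N → a • p ∈ N
  smul_mem_dom (a : G) {p : T} : p ∈ D → a • p ∈ D
  map_smul (a : G) {p : T} : p ∈ D → E (a • p) = a • E p

variable [IsIsometricSMul G X]

lemma tubeRadius_smul (ha : IsEquivariantExp G pr n N D E)
    (hQ : ∀ (a : G) S, Q S → Q ((fun p => a • p) '' S)) (a : G) (y : X) :
    tubeRadius pr n N Q (a • y) = tubeRadius pr n N Q y := by
  have key : ∀ (a : G) (y : X), tubeRadius pr n N Q y ≤ tubeRadius pr n N Q (a • y) := by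
    intro a y
    refine sSup_le_sSup fun r hr => ⟨hr.1, ?_⟩
    have : tubeBall pr n N (a • y) r = (fun p => a • p) '' tubeBall pr n N y r := by
      ext p
      constructor
      · rintro ⟨hp, h1, h2⟩
        refine ⟨a⁻¹ • p, ⟨ha.smul_mem _ hp, ?_, ?_⟩, smul_inv_smul a p⟩
        · rwa [ha.proj_smul, ← edist_smul_left a, smul_inv_smul]
        · rwa [ha.norm_smul]
      · rintro ⟨q, ⟨hq, h1, h2⟩, rfl⟩
        refine ⟨ha.smul_mem _ hq, ?_, ?_⟩
        · rwa [ha.proj_smul, edist_smul_left]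
        · rwa [ha.norm_smul]
    rw [this]
    exact hQ a _ hr.2
  refine le_antisymm ?_ (key a y)
  simpa using key a⁻¹ (a • y)

end Group

variable [TopologicalSpace T]

lemma isOpen_edist_norm_lt (hpr : Continuous pr) (hn : Continuous n) (y : X) (r : ℝ≥0∞) :
    IsOpen {p | edist y (pr p) < r ∧ (n p : ℝ≥0∞) < r} :=
  (isOpen_lt (continuous_const.edist hpr) continuous_const).inter
    (isOpen_lt (ENNReal.continuous_coe.comp hn) continuous_const)

lemma tubeBall_of_subset (hb : Continuous pr ∧ Continuous n)
    (hQ : ∀ S O, Q S → IsOpen O → Q (S ∩ O))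
    {S : Set T} (hS : Q S) {y : X} {r : ℝ≥0∞}
    (h : tubeBall pr n N y r ⊆ S) (hSN : S ⊆ N) : Q (tubeBall pr n N y r) := by
  have : tubeBall pr n N y r = S ∩ {p | edist y (pr p) < r ∧ (n p : ℝ≥0∞) < r} :=
    (subset_inter h inter_subset_right).antisymm (inter_subset_inter_left _ hSN)
  rw [this]
  exact hQ _ _ hS (isOpen_edist_norm_lt hb.1 hb.2 y r)

lemma tubeBall_of_lt_tubeRadius (hb : Continuous pr ∧ Continuous n)
    (hQ : ∀ S O, Q S → IsOpen O → Q (S ∩ O))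
    {y : X} {r : ℝ≥0∞} (h : r < tubeRadius pr n N Q y) :
    Q (tubeBall pr n N y r) := by
  obtain ⟨r', ⟨h1, h2⟩, h3⟩ := lt_sSup_iff.1 h
  refine tubeBall_of_subset hb hQ h2 (tubeBall_subset ?_ ?_) inter_subset_left
  · simpa using h3.le
  · exact ne_top_of_le_ne_top ENNReal.one_ne_top h1

lemma tubeRadius_le_add (hb : Continuous pr ∧ Continuous n)
    (hQ : ∀ S O, Q S → IsOpen O → Q (S ∩ O))
    (y y' : X) :
    tubeRadius pr n N Q y ≤ tubeRadius pr n N Q y' + edist y y' := by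
  refine sSup_le ?_
  rintro r ⟨h1, h2⟩
  by_cases h : edist y y' ≤ r
  · rw [← tsub_le_iff_right]
    refine le_sSup ⟨tsub_le_self.trans h1, ?_⟩
    refine tubeBall_of_subset hb hQ h2 (tubeBall_subset ?_ ?_) inter_subset_left
    · exact (tsub_add_cancel_of_le h).le
    · exact ne_top_of_le_ne_top ENNReal.one_ne_top h1
  · exact (not_le.1 h).le.trans le_add_self

lemma continuous_tubeRadius (hb : Continuous pr ∧ Continuous n)
    (hQ : ∀ S O, Q S → IsOpen O → Q (S ∩ O)) :
    Continuous (tubeRadius pr n N Q) :=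
  continuous_of_le_add_edist 1 ENNReal.one_ne_top fun y y' => by
    simpa using tubeRadius_le_add hb hQ y y'

lemma tubeRadius_pos (hb : Continuous pr ∧ Continuous n)
    (hQ : ∀ S O, Q S → IsOpen O → Q (S ∩ O))
    {y : X} (hW : ∃ W : Set T, (∃ r : ℝ≥0∞, 0 < r ∧
      {p | edist y (pr p) < r ∧ (n p : ℝ≥0∞) < r} ⊆ W) ∧ Q (N ∩ W)) :
    0 < tubeRadius pr n N Q y := by
  obtain ⟨W, ⟨r, hr, hrW⟩, hQW⟩ := hW
  refine (lt_min hr one_pos).trans_le (le_sSup ⟨min_le_right r 1, ?_⟩)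
  refine tubeBall_of_subset hb hQ hQW ?_ inter_subset_left
  rintro p ⟨hp, h1, h2⟩
  exact ⟨hp, hrW ⟨h1.trans_le (min_le_left _ _), h2.trans_le (min_le_left _ _)⟩⟩

section Group

variable {G : Type*} [Group G] [MulAction G X] [MulAction G T] [IsIsometricSMul G X]

lemma OpenEmbedsOn.smul [ContinuousConstSMul G T] (ha : IsEquivariantExp G pr n N D E)
    (a : G) (h : OpenEmbedsOn E D S) : OpenEmbedsOn E D ((fun p => a • p) '' S) where
  subset := by
    rintro _ ⟨p, hp, rfl⟩
    exact ha.smul_mem_dom a (h.subset hp)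
  injOn := by
    rintro _ ⟨p, hp, rfl⟩ _ ⟨q, hq, rfl⟩ hpq
    simp only [ha.map_smul a (h.subset hp), ha.map_smul a (h.subset hq)] at hpq
    exact congrArg _ (h.injOn hp hq (smul_left_cancel a hpq))
  continuousOn := by
    have h1 : ContinuousOn (fun p => a • E (a⁻¹ • p)) ((fun p => a • p) '' S) := by
      refine (h.continuousOn.comp (continuous_const_smul a⁻¹).continuousOn ?_).const_smul a
      rintro _ ⟨p, hp, rfl⟩
      simpa using hp
    refine h1.congr ?_
    rintro _ ⟨p, hp, rfl⟩
    simp [ha.map_smul a (h.subset hp)]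
  isOpen_image O hO := by
    have h1 := (h.isOpen_image _ (hO.preimage (continuous_const_smul a))).smul a
    convert h1 using 1
    ext x
    constructor
    · rintro ⟨_, ⟨⟨p, hp, rfl⟩, hpO⟩, rfl⟩
      exact ⟨E p, ⟨p, ⟨hp, hpO⟩, rfl⟩, (ha.map_smul a (h.subset hp)).symm⟩
    · rintro ⟨_, ⟨p, ⟨hp, hpO⟩, rfl⟩, rfl⟩
      exact ⟨a • p, ⟨⟨p, hp, rfl⟩, hpO⟩, ha.map_smul a (h.subset hp)⟩

/-- There is an invariant radius function `ρ` such that `E` is an embedding on the vectors in `N` of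
length less than `ρ`. Here `ρ` is bounded by half the radius `r` of the balls on which `E` is an
embedding, and is so small that `E` moves base points by less than a quarter of `r`. -/
lemma exists_invariant_radius [MulAction ℝ T] [ContinuousConstSMul G T]
    (hb : IsNormedBundle pr n z)
    (ha : IsEquivariantExp G pr n N D E) {Y : Set X} (hNY : ∀ p ∈ N, pr p ∈ Y)
    (hz : ∀ y ∈ Y, z y ∈ N) (hEz : ∀ y, E (z y) = y)
    (hloc : ∀ y ∈ Y, ∃ W, IsOpen W ∧ z y ∈ W ∧ OpenEmbedsOn E D (N ∩ W)) :
    ∃ ρ : X → ℝ≥0, Continuous ρ ∧ (∀ y ∈ Y, 0 < ρ y) ∧ (∀ (a : G) y, ρ (a • y) = ρ y) ∧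
      OpenEmbedsOn E D (N ∩ {p | n p < ρ (pr p)}) := by
  have hc := And.intro hb.continuous_proj hb.continuous_norm
  have hQ₁ : ∀ S O, OpenEmbedsOn E D S → IsOpen O → OpenEmbedsOn E D (S ∩ O) :=
    fun S O h hO => h.inter hO
  set r := tubeRadius pr n N (OpenEmbedsOn E D)
  have hrc : Continuous r := continuous_tubeRadius hc hQ₁
  have hra : ∀ (a : G) y, r (a • y) = r y := tubeRadius_smul ha fun a S h => h.smul ha a
  have hr1 : ∀ y, r y ≠ ⊤ := fun y => ne_top_of_le_ne_top ENNReal.one_ne_top (tubeRadius_le_one y)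
  have hr0 : ∀ y ∈ Y, 0 < r y := fun y hy => by
    obtain ⟨W, hW, hyW, h⟩ := hloc y hy
    exact tubeRadius_pos hc hQ₁ ⟨W, hb.exists_subset y W hW hyW, h⟩
  -- on balls of radius less than `s y`, the map `E` moves base points by less than a quarter of `r`
  let Q : Set T → Prop := fun S => ∀ p ∈ S, p ∈ D ∧ edist (pr p) (E p) < r (pr p) / 4
  have hQ₂ : ∀ S O, Q S → IsOpen O → Q (S ∩ O) := fun S O h _ p hp => h p hp.1
  set s := tubeRadius pr n N Q
  have hsc : Continuous s := continuous_tubeRadius hc hQ₂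
  have hsa : ∀ (a : G) y, s (a • y) = s y := tubeRadius_smul ha fun a S h => by
    rintro _ ⟨p, hp, rfl⟩
    obtain ⟨h1, h2⟩ := h p hp
    refine ⟨ha.smul_mem_dom a h1, ?_⟩
    rwa [ha.map_smul a h1, ha.proj_smul, edist_smul_left, hra]
  have hs0 : ∀ y ∈ Y, 0 < s y := fun y hy => by
    obtain ⟨W, hW, hyW, h⟩ := hloc y hy
    have hyN : z y ∈ N ∩ W := ⟨hz y hy, hyW⟩
    have h1 : ContinuousWithinAt (fun p => edist (pr p) (E p)) (N ∩ W) (z y) :=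
      hc.1.continuousWithinAt.edist (h.continuousOn _ hyN)
    have h2 : ContinuousWithinAt (fun p => r (pr p) / 4) (N ∩ W) (z y) :=
      ((ENNReal.continuous_div_const 4 (by norm_num)).comp
        (hrc.comp hc.1)).continuousWithinAt
    have h3 : ∀ᶠ p in 𝓝[N ∩ W] (z y), edist (pr p) (E p) < r (pr p) / 4 := by
      refine h1.eventually_lt h2 ?_
      change edist (pr (z y)) (E (z y)) < r (pr (z y)) / 4
      rw [hEz, hb.proj_zero, edist_self]
      exact ENNReal.div_pos (hr0 y hy).ne' (by norm_num)
    obtain ⟨U, hUo, hyU, hU⟩ := mem_nhdsWithin.1 h3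
    refine tubeRadius_pos hc hQ₂
      ⟨W ∩ U, hb.exists_subset y _ (hW.inter hUo) ⟨hyW, hyU⟩, fun p hp => ?_⟩
    exact ⟨h.subset ⟨hp.1, hp.2.1⟩, hU ⟨hp.2.2, hp.1, hp.2.1⟩⟩
  let R : X → ℝ≥0∞ := fun y => min (r y) (s y) / 2
  have hRr : ∀ y, R y ≤ r y / 2 := fun y => ENNReal.div_le_div_right (min_le_left _ _) _
  have hRt : ∀ y, R y ≠ ⊤ := fun y =>
    ne_top_of_le_ne_top (ENNReal.div_ne_top (hr1 y) (by norm_num)) (hRr y)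
  have hRc : Continuous R := (ENNReal.continuous_div_const 2 (by norm_num)).comp (hrc.min hsc)
  have hRcoe : ∀ y, ((R y).toNNReal : ℝ≥0∞) = R y := fun y => ENNReal.coe_toNNReal (hRt y)
  have hρc : Continuous fun y => (R y).toNNReal :=
    ENNReal.continuousOn_toNNReal.comp_continuous hRc hRt
  have hR0 : ∀ y ∈ Y, 0 < R y := fun y hy =>
    ENNReal.div_pos (lt_min (hr0 y hy) (hs0 y hy)).ne' (by norm_num)
  refine ⟨fun y => (R y).toNNReal, hρc, fun y hy => ?_, fun a y => ?_, ?_⟩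
  · exact ENNReal.toNNReal_pos (hR0 y hy).ne' (hRt y)
  · simp only [R, hra, hsa]
  have hlt : ∀ p ∈ N ∩ {p | n p < (R (pr p)).toNNReal}, (n p : ℝ≥0∞) < R (pr p) := by
    rintro p ⟨-, hp⟩
    rw [← hRcoe]
    exact ENNReal.coe_lt_coe.2 hp
  have hmove : ∀ p ∈ N ∩ {p | n p < (R (pr p)).toNNReal},
      edist (pr p) (E p) < r (pr p) / 4 := by
    intro p hp
    have hy := hNY p hp.1
    have h1 : R (pr p) < s (pr p) :=
      (ENNReal.div_le_div_right (min_le_right _ _) _).trans_lt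
        (ENNReal.half_lt_self (hs0 _ hy).ne'
          (ne_top_of_le_ne_top ENNReal.one_ne_top (tubeRadius_le_one _)))
    refine (tubeBall_of_lt_tubeRadius hc hQ₂ h1 p ⟨hp.1, ?_, hlt p hp⟩).2
    rw [edist_self]
    exact hR0 _ hy
  have hhalf : ∀ y ∈ Y, OpenEmbedsOn E D (tubeBall pr n N y (r y / 2)) := fun y hy =>
    tubeBall_of_lt_tubeRadius hc hQ₁ (ENNReal.half_lt_self (hr0 y hy).ne' (hr1 y))
  have hpos : ∀ y ∈ Y, 0 < r y / 2 := fun y hy => ENNReal.div_pos (hr0 y hy).ne' (by norm_num)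
  refine OpenEmbedsOn.of_locally ?_ fun p hp => ?_
  -- two vectors with the same image have base points at distance less than half of the larger `r`,
  -- so that they lie in a common ball on which `E` is injective
  · have key : ∀ p ∈ N ∩ {p | n p < (R (pr p)).toNNReal},
        ∀ q ∈ N ∩ {p | n p < (R (pr p)).toNNReal}, r (pr q) ≤ r (pr p) → E p = E q → p = q := by
      intro p hp q hq hle h
      have hy := hNY p hp.1
      refine (hhalf _ hy).injOn ⟨hp.1, ?_, (hlt p hp).trans_le (hRr _)⟩
        ⟨hq.1, ?_, ((hlt q hq).trans_le (hRr _)).trans_le (ENNReal.div_le_div_right hle _)⟩ h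
      · rw [edist_self]
        exact hpos _ hy
      · calc edist (pr p) (pr q) ≤ edist (pr p) (E p) + edist (pr q) (E q) := by
              rw [← h, edist_comm (pr q)]
              exact edist_triangle _ _ _
          _ < r (pr p) / 4 + r (pr q) / 4 := ENNReal.add_lt_add (hmove p hp) (hmove q hq)
          _ ≤ r (pr p) / 4 + r (pr p) / 4 := by gcongr
          _ = r (pr p) / 2 := by
              rw [← ENNReal.add_halves (r (pr p) / 2)]
              have : r (pr p) / 2 / 2 = r (pr p) / 4 := by
                rw [div_eq_mul_inv, div_eq_mul_inv, mul_assoc,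
                  ← ENNReal.mul_inv (by simp) (by simp)]
                norm_num [div_eq_mul_inv]
              rw [this]
    intro p hp q hq h
    rcases le_total (r (pr q)) (r (pr p)) with hle | hle
    · exact key p hp q hq hle h
    · exact (key q hq p hp hle h.symm).symm
  · have hy := hNY p hp.1
    have ho : IsOpen {p | n p < (R (pr p)).toNNReal} := isOpen_lt hc.2 (hρc.comp hc.1)
    refine ⟨_, isOpen_edist_norm_lt hc.1 hc.2 (pr p) (r (pr p) / 2), ⟨?_, ?_⟩, ?_⟩
    · rw [edist_self]
      exact hpos _ hy
    · exact (hlt p hp).trans_le (hRr _)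
    · rw [inter_right_comm]
      exact (hhalf _ hy).inter ho

end Group

/-- The fibrewise radial map `p ↦ ρ / (1 + ‖p‖) • p` shrinks `N` to the vectors of length less than
`ρ`. -/
lemma isOpenEmbedding_shrink [MulAction ℝ T] [ContinuousSMul ℝ T] (hb : IsNormedBundle pr n z)
    {ρ : X → ℝ≥0} (hρ : Continuous ρ) (hpos : ∀ p ∈ N, 0 < ρ (pr p))
    (hN : ∀ (t : ℝ), ∀ p ∈ N, t • p ∈ N)
    (hE : OpenEmbedsOn E D (N ∩ {p | n p < ρ (pr p)})) :
    (∀ p ∈ N, ((ρ (pr p) : ℝ) / (1 + n p)) • p ∈ N ∩ {p | n p < ρ (pr p)}) ∧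
      IsOpenEmbedding fun p : N => E (((ρ (pr p) : ℝ) / (1 + n p)) • (p : T)) := by
  have hnorm : ∀ p, (n (((ρ (pr p) : ℝ) / (1 + n p)) • p) : ℝ) =
      (ρ (pr p) : ℝ) / (1 + n p) * n p := fun p => by
    rw [hb.norm_smul, NNReal.coe_mul, coe_nnnorm, Real.norm_of_nonneg (by positivity)]
  have hmem : ∀ p ∈ N, ((ρ (pr p) : ℝ) / (1 + n p)) • p ∈ N ∩ {p | n p < ρ (pr p)} := by
    intro p hp
    have h0 : (0 : ℝ) < ρ (pr p) := hpos p hp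
    refine ⟨hN _ p hp, ?_⟩
    rw [mem_ofPred_eq, hb.proj_smul, ← NNReal.coe_lt_coe, hnorm, div_mul_eq_mul_div,
      div_lt_iff₀ (by positivity)]
    nlinarith
  -- the inverse of the radial map
  let θ : T → T := fun p => ((ρ (pr p) : ℝ) - n p)⁻¹ • p
  have hθ : ∀ p ∈ N, θ (((ρ (pr p) : ℝ) / (1 + n p)) • p) = p := by
    intro p hp
    have h0 : (0 : ℝ) < ρ (pr p) := hpos p hp
    have h1 : (0 : ℝ) ≤ n p := (n p).2
    simp only [θ]
    rw [hnorm, hb.proj_smul, smul_smul]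
    convert one_smul ℝ p using 2
    field_simp
    ring
  have hθ' : ∀ p ∈ N ∩ {p | n p < ρ (pr p)},
      ((ρ (pr (θ p)) : ℝ) / (1 + n (θ p))) • θ p = p := by
    rintro p ⟨-, hp⟩
    have h0 : (0 : ℝ) < ρ (pr p) - n p := sub_pos.2 (NNReal.coe_lt_coe.2 hp)
    have h2 : (0 : ℝ) < ρ (pr p) := h0.trans_le (sub_le_self _ (n p).2)
    simp only [θ]
    rw [hb.proj_smul, hb.norm_smul, NNReal.coe_mul, coe_nnnorm,
      Real.norm_of_nonneg (inv_nonneg.2 h0.le), smul_smul]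
    convert one_smul ℝ p using 2
    have h3 : (1 : ℝ) + (ρ (pr p) - n p : ℝ)⁻¹ * n p = ρ (pr p) * (ρ (pr p) - n p : ℝ)⁻¹ := by
      field_simp
      ring
    rw [h3]
    field_simp
  have hcont : Continuous fun p : T => ((ρ (pr p) : ℝ) / (1 + n p)) • p := by
    refine Continuous.smul (Continuous.div ?_ ?_ fun p => by positivity) continuous_id
    · exact NNReal.continuous_coe.comp (hρ.comp hb.continuous_proj)
    · exact continuous_const.add (NNReal.continuous_coe.comp hb.continuous_norm)
  have hθc : ContinuousOn θ (N ∩ {p | n p < ρ (pr p)}) := by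
    refine ContinuousOn.smul (ContinuousOn.inv₀ ?_ ?_) continuousOn_id
    · exact ((NNReal.continuous_coe.comp (hρ.comp hb.continuous_proj)).sub
        (NNReal.continuous_coe.comp hb.continuous_norm)).continuousOn
    · rintro p ⟨-, hp⟩
      exact (sub_pos.2 (NNReal.coe_lt_coe.2 hp)).ne'
  refine ⟨hmem, .of_continuous_injective_isOpenMap ?_ ?_ ?_⟩
  · exact hE.continuousOn.comp_continuous (hcont.comp continuous_subtype_val)
      fun p => hmem p p.2
  · intro p q h
    have h1 := congrArg θ (hE.injOn (hmem p p.2) (hmem q q.2) h)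
    rw [hθ p p.2, hθ q q.2] at h1
    exact Subtype.ext h1
  · intro O hO
    obtain ⟨O', hO', rfl⟩ := isOpen_induced_iff.1 hO
    obtain ⟨V, hV, hVe⟩ := continuousOn_iff'.1 hθc O' hO'
    convert hE.isOpen_image V hV using 1
    ext x
    constructor
    · rintro ⟨p, hp, rfl⟩
      refine ⟨_, ⟨hmem p p.2, ?_⟩, rfl⟩
      have : ((ρ (pr p) : ℝ) / (1 + n p)) • (p : T) ∈ θ ⁻¹' O' ∩ (N ∩ {p | n p < ρ (pr p)}) :=
        ⟨by rw [mem_preimage, hθ p p.2]; exact hp, hmem p p.2⟩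
      rw [hVe] at this
      exact this.1
    · rintro ⟨p, ⟨hp, hpV⟩, rfl⟩
      have : p ∈ θ ⁻¹' O' ∩ (N ∩ {p | n p < ρ (pr p)}) := by
        rw [hVe]
        exact ⟨hpV, hp⟩
      exact ⟨⟨θ p, hN _ p hp.1⟩, this.1, congrArg E (hθ' p hp)⟩

/-- The gluing of local tubular neighbourhoods to a total equivariant one: `N` is first shrunk to
the vectors shorter than an invariant radius function, and then embedded by `E`. -/
theorem exists_total_equivariant_tube {G : Type*} [Group G] [MulAction G X] [MulAction G T]
    [IsIsometricSMul G X] [MulAction ℝ T] [ContinuousSMul ℝ T] [ContinuousConstSMul G T]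
    [SMulCommClass G ℝ T] (hb : IsNormedBundle pr n z) (ha : IsEquivariantExp G pr n N D E)
    {Y : Set X} (hNY : ∀ p ∈ N, pr p ∈ Y) (hN : ∀ (t : ℝ), ∀ p ∈ N, t • p ∈ N)
    (hz : ∀ y ∈ Y, z y ∈ N) (hEz : ∀ y, E (z y) = y)
    (hloc : ∀ y ∈ Y, ∃ W, IsOpen W ∧ z y ∈ W ∧ OpenEmbedsOn E D (N ∩ W)) :
    ∃ (U : Set X) (φ : N ≃ₜ U), IsOpen U ∧ (∀ y (hy : y ∈ Y), (φ ⟨z y, hz y hy⟩ : X) = y) ∧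
      ∀ (a : G) (p : N), (φ ⟨a • (p : T), ha.smul_mem a p.2⟩ : X) = a • (φ p : X) := by
  obtain ⟨ρ, hρ, hpos, hρa, hE⟩ := exists_invariant_radius hb ha hNY hz hEz hloc
  obtain ⟨hmem, hemb⟩ := isOpenEmbedding_shrink hb hρ (fun p hp => hpos _ (hNY p hp)) hN hE
  refine ⟨_, hemb.isEmbedding.toHomeomorph, hemb.isOpen_range, fun y hy => ?_, fun a p => ?_⟩
  · change E (_ • z y) = y
    rw [hb.smul_zero, hEz]
  · change E (((ρ (pr (a • (p : T))) : ℝ) / (1 + n (a • (p : T)))) • a • (p : T)) =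
      a • E (((ρ (pr p) : ℝ) / (1 + n p)) • (p : T))
    rw [ha.proj_smul, ha.norm_smul, hρa, ← smul_comm, ha.map_smul a (hE.subset (hmem p p.2))]

end Gluing

/-! ### The exponential map near the zero section of the normal bundle -/

section LocalStructure

variable {H : Type*} [NormedAddCommGroup H] [InnerProductSpace ℝ H]
  {X : Type*} [TopologicalSpace X] [ChartedSpace H X] [IsManifold 𝓘(ℝ, H) ∞ X]
  {g : StrongRiemannianMetric H X} {Y : Set X}
  {c : OpenPartialHomeomorph X H} {F K : Submodule ℝ H}
  {e : Trivialization H (TotalSpace.proj : TangentBundle 𝓘(ℝ, H) X → X)}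

/-- At a zero vector, the coordinate expression of a trivialization of the tangent bundle has the
derivative `(x, k) ↦ (x, A k)`, with `A` the fibre isomorphism at the base point. -/
lemma hasStrictFDerivAt_tangentCoord_trivVec [e.IsLinear ℝ] (hc : IsCoord c)
    (he : ContMDiffOn (𝓘(ℝ, H).prod 𝓘(ℝ, H)) 𝓘(ℝ, H).tangent ∞ e.toOpenPartialHomeomorph.symm
      e.target) {x : H} (hx : x ∈ c.target) (hxe : c.symm x ∈ e.baseSet) {A : H →L[ℝ] H}
    (hA : ∀ k, A k = mfderiv 𝓘(ℝ, H) 𝓘(ℝ, H) c (c.symm x) (e.symmL ℝ (c.symm x) k)) :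
    HasStrictFDerivAt (fun q => tangentCoord c (trivVec c e q))
      ((ContinuousLinearMap.id ℝ H).prodMap A) (x, (0 : H)) := by
  have h := (contDiffAt_tangentCoord_trivVec hc he (q := (x, 0)) hx hxe).hasStrictFDerivAt
    (by simp)
  suffices hz : fderiv ℝ (fun q => tangentCoord c (trivVec c e q)) (x, (0 : H)) =
      (ContinuousLinearMap.id ℝ H).prodMap A by rwa [hz] at h
  apply ContinuousLinearMap.prod_ext <;> ext1 v
  · have h1 : HasFDerivAt (fun y : H => tangentCoord c (trivVec c e (y, (0 : H)))) _ x :=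
      h.hasFDerivAt.comp x (f := fun y : H => (y, (0 : H)))
        ((hasFDerivAt_id x).prodMk (hasFDerivAt_const (0 : H) x))
    have h2 : (fun y : H => tangentCoord c (trivVec c e (y, (0 : H)))) =ᶠ[𝓝 x]
        fun y => (y, (0 : H)) := by
      filter_upwards [c.open_target.mem_nhds hx,
        (c.continuousAt_symm hx).eventually_mem (e.open_baseSet.mem_nhds hxe)] with y hy hye
      rw [tangentCoord_trivVec hy hye, map_zero]
      exact congrArg (Prod.mk y) (map_zero _)
    have h3 := (h1.congr_of_eventuallyEq h2.symm).unique
      ((hasFDerivAt_id x).prodMk (hasFDerivAt_const (0 : H) x))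
    have := congrArg (fun L : H →L[ℝ] H × H => L v) h3
    simpa using this
  · have h1 : HasFDerivAt (fun k : H => tangentCoord c (trivVec c e (x, k))) _ 0 :=
      h.hasFDerivAt.comp 0 (f := fun k : H => (x, k))
        ((hasFDerivAt_const x (0 : H)).prodMk (hasFDerivAt_id (0 : H)))
    have h2 : (fun k : H => tangentCoord c (trivVec c e (x, k))) = fun k => (x, A k) := by
      ext1 k
      rw [tangentCoord_trivVec hx hxe, hA]
      rfl
    rw [h2] at h1
    have h3 := h1.unique ((hasFDerivAt_const x (0 : H)).prodMk A.hasFDerivAt)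
    have := congrArg (fun L : H →L[ℝ] H × H => L v) h3
    simpa using this

/-- The model fibre of the normal bundle, moved to the coordinates of a straightening chart, is a
complement of `F`, as the metric is coercive on the closed subspace `F`. -/
lemma bijective_add_of_normalSet [CompleteSpace H] [e.IsLinear ℝ] (hc : IsCoord c)
    (hF : IsClosed (F : Set H)) (hYF : ∀ x ∈ c.source, (x ∈ Y ↔ c x ∈ F))
    (hK : ∀ p : TangentBundle 𝓘(ℝ, H) X, p.proj ∈ e.baseSet → p.proj ∈ Y →
      (p ∈ normalSet g Y ↔ (e p).2 ∈ K)) {y : X} (hy : y ∈ Y) (hyc : y ∈ c.source)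
    (hye : y ∈ e.baseSet) {A : H →L[ℝ] H}
    (hA : ∀ k, A k = mfderiv 𝓘(ℝ, H) 𝓘(ℝ, H) c y (e.symmL ℝ y k)) :
    Function.Bijective (fun q : F × K => (q.1 : H) + A q.2) := by
  have hco := isCoercive_chartMetric g hc (c.map_source hyc)
  -- `A` maps `K` onto the orthogonal complement of `F`
  have hAK : ∀ k, k ∈ K ↔ ∀ f ∈ F, chartMetric g c (c y) (A k) f = 0 := by
    intro k
    have h1 := hK (⟨y, e.symmL ℝ y k⟩ : TangentBundle 𝓘(ℝ, H) X) hye hy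
    have h2 : (e (⟨y, e.symmL ℝ y k⟩ : TangentBundle 𝓘(ℝ, H) X)).2 = k := by
      rw [e.symmL_apply hye, e.apply_mk_symm hye]
    rw [h2] at h1
    rw [← h1, hA]
    exact mem_normalSet_iff g hc hF hYF (p := (⟨y, e.symmL ℝ y k⟩ : TangentBundle 𝓘(ℝ, H) X)) hyc hy
  have hAinj : ∀ k, A k = 0 → k = 0 := by
    intro k hk
    rw [hA] at hk
    have h1 := hc.mfderiv_symm_mfderiv hyc (e.symmL ℝ y k)
    have h2 : e.symmL ℝ y k = 0 := h1.symm.trans ((congrArg _ hk).trans (map_zero _))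
    have h3 := e.continuousLinearMapAt_symmL (R := ℝ) hye k
    rw [← h3, h2, map_zero]
  have hAsurj : ∀ n, ∃ k, A k = n := by
    intro n
    refine ⟨e.continuousLinearMapAt ℝ y (mfderiv 𝓘(ℝ, H) 𝓘(ℝ, H) c.symm (c y) n :
      TangentSpace 𝓘(ℝ, H) y), ?_⟩
    rw [hA]
    refine (congrArg (mfderiv 𝓘(ℝ, H) 𝓘(ℝ, H) c y : H →L[ℝ] H)
      (e.symmL_continuousLinearMapAt (R := ℝ) hye _)).trans ?_
    exact hc.mfderiv_mfderiv_symm' hyc n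
  constructor
  · have hinj : ∀ q : F × K, (q.1 : H) + A q.2 = 0 → q = 0 := by
      rintro ⟨⟨f, hf⟩, ⟨k, hk⟩⟩ h
      simp only at h
      have h1 := (hAK k).1 hk f hf
      rw [← neg_eq_of_add_eq_zero_right h, map_neg, neg_apply, neg_eq_zero] at h1
      have h2 := eq_zero_of_coercive hco h1
      subst h2
      have := hAinj k (by simpa using h)
      subst this
      rfl
    intro q q' h
    refine sub_eq_zero.1 (hinj _ ?_)
    simp only at h
    simp only [Prod.fst_sub, Prod.snd_sub, AddSubgroupClass.coe_sub, map_sub]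
    rw [← sub_eq_zero] at h
    rw [← h]
    abel
  · intro h
    obtain ⟨f, hf, hperp⟩ := exists_sub_orthogonal hco hF h
    obtain ⟨k, hk⟩ := hAsurj (h - f)
    refine ⟨⟨⟨f, hf⟩, ⟨k, (hAK k).2 (by rwa [hk])⟩⟩, ?_⟩
    simp [hk]

/-- The exponential map is an open embedding on a neighbourhood of each zero vector in the normal
bundle: in coordinates its derivative is `(f, k) ↦ f + A k`, with `f` tangent and `A k` normal to
`Y`. -/
lemma exists_openEmbedsOn_expMap [CompleteSpace H] [T2Space X] (hY : IsSubmanifold (H := H) Y)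
    (hN : IsSmoothSubbundleOver Y (normalSet g Y)) {y : X} (hy : y ∈ Y) :
    ∃ W : Set (TangentBundle 𝓘(ℝ, H) X), IsOpen W ∧ (⟨y, 0⟩ : TangentBundle 𝓘(ℝ, H) X) ∈ W ∧
      OpenEmbedsOn (expMap g) (expDomain g) (normalSet g Y ∩ W) := by
  obtain ⟨c, hc', hyc, F, hF, hYF⟩ := hY y hy
  obtain ⟨e, hye, hlin, -, he, K, hKc, hK⟩ := hN y hy
  have hc := IsCoord.of_mem_maximalAtlas hc'
  have : CompleteSpace F := hF.completeSpace_coe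
  have : CompleteSpace K := hKc.completeSpace_coe
  let A : H →L[ℝ] H := (mfderiv 𝓘(ℝ, H) 𝓘(ℝ, H) c y : H →L[ℝ] H).comp
    (e.symmL ℝ y : H →L[ℝ] H)
  have hA : ∀ k, A k = mfderiv 𝓘(ℝ, H) 𝓘(ℝ, H) c y (e.symmL ℝ y k) := fun k => rfl
  have hbij := bijective_add_of_normalSet hc hF hYF hK hy hyc hye hA
  have hx : c y ∈ c.target := c.map_source hyc
  have hxF : c y ∈ F := (hYF y hyc).1 hy
  have hxe : c.symm (c y) ∈ e.baseSet := by rwa [c.left_inv hyc]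
  let ι : F × K →L[ℝ] H × H := F.subtypeL.prodMap K.subtypeL
  let x₀ : F × K := (⟨c y, hxF⟩, 0)
  have hι : IsInducing ι := IsInducing.subtypeVal.prodMap IsInducing.subtypeVal
  have hι0 : ι x₀ = (c y, 0) := rfl
  -- the exponential map in the coordinates of the normal bundle, and its derivative
  let Φ : F × K → H := fun s => c (expMap g (trivVec c e (ι s)))
  let D : F × K →L[ℝ] H := F.subtypeL.comp (ContinuousLinearMap.fst ℝ F K) +
    (A.comp K.subtypeL).comp (ContinuousLinearMap.snd ℝ F K)
  have hQ : HasStrictFDerivAt (fun q => tangentCoord c (trivVec c e q))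
      ((ContinuousLinearMap.id ℝ H).prodMap A) (c y, (0 : H)) :=
    hasStrictFDerivAt_tangentCoord_trivVec hc he hx hxe (fun k => by
      rw [hA]
      have : ∀ q, q = y → (mfderiv 𝓘(ℝ, H) 𝓘(ℝ, H) c y : H →L[ℝ] H) (e.symmL ℝ y k) =
        (mfderiv 𝓘(ℝ, H) 𝓘(ℝ, H) c q : H →L[ℝ] H) (e.symmL ℝ q k) := by rintro q rfl; rfl
      exact this _ (c.left_inv hyc))
  -- the parameters for which everything is defined
  have hpar : ∀ᶠ q in 𝓝 (c y, (0 : H)), q.1 ∈ c.target ∧ c.symm q.1 ∈ e.baseSet := by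
    have h1 : ∀ᶠ x in 𝓝 (c y), x ∈ c.target ∧ c.symm x ∈ e.baseSet :=
      Filter.Eventually.and (c.open_target.mem_nhds hx)
        ((c.continuousAt_symm hx).eventually_mem (e.open_baseSet.mem_nhds hxe))
    exact (continuousAt_fst (p := (c y, (0 : H)))).eventually h1
  have hQx : tangentCoord c (trivVec c e (c y, (0 : H))) = (c y, 0) := by
    rw [tangentCoord_trivVec hx hxe, map_zero]
    exact congrArg (Prod.mk (c y)) (map_zero _)
  have hQo : ∀ᶠ q in 𝓝 (c y, (0 : H)),
      ofCoord c (tangentCoord c (trivVec c e q)) = trivVec c e q := by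
    filter_upwards [hpar] with q hq
    refine ofCoord_mfderiv hc ?_
    rw [trivVec_proj hq.2]
    exact c.map_target hq.1
  have hexp : ∀ᶠ q in 𝓝 (c y, (0 : H)),
      trivVec c e q ∈ expDomain g ∧ expMap g (trivVec c e q) ∈ c.source := by
    have h1 := eventually_ofCoord_mem_expDomain (g := g) hc hx
    rw [← hQx] at h1
    filter_upwards [hQ.continuousAt.eventually h1, hQo] with q h2 h3
    rwa [h3] at h2
  have hΦ : HasStrictFDerivAt Φ D x₀ := by
    have h1 := hasStrictFDerivAt_expMap (g := g) hc hx
    rw [← hQx] at h1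
    have h2 := h1.comp (c y, (0 : H)) hQ
    have h3 := h2.congr_of_eventuallyEq
      (f₁ := fun q => c (expMap g (trivVec c e q))) (by
        filter_upwards [hQo] with q hq
        simp only [hq])
    rw [← hι0] at h3
    have h4 := h3.comp x₀ ι.hasStrictFDerivAt
    have hD : D = ((ContinuousLinearMap.fst ℝ H H + ContinuousLinearMap.snd ℝ H H).comp
        ((ContinuousLinearMap.id ℝ H).prodMap A)).comp ι := rfl
    rw [hD]
    exact h4
  have hDbij : Function.Bijective D := hbij
  let D' : (F × K) ≃L[ℝ] H := ContinuousLinearEquiv.ofBijective D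
    (LinearMap.ker_eq_bot.2 hDbij.1) (LinearMap.range_eq_top.2 hDbij.2)
  have hΦ' : HasStrictFDerivAt Φ (D' : F × K →L[ℝ] H) x₀ := hΦ
  -- the inverse function theorem
  let Ψ := hΦ'.toOpenPartialHomeomorph Φ
  have hΨ : ∀ s, Ψ s = Φ s := fun s => rfl
  have hx₀ : x₀ ∈ Ψ.source := hΦ'.mem_toOpenPartialHomeomorph_source
  obtain ⟨V₀, hV₀, hV₀'⟩ := hι.isOpen_iff.1 Ψ.open_source
  obtain ⟨V, hVsub, hVo, hVx⟩ := mem_nhds_iff.1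
    ((hpar.and hexp).and (hV₀.mem_nhds (show (c y, (0 : H)) ∈ V₀ by
      rw [← hι0, ← mem_preimage, hV₀']; exact hx₀)))
  have hVpar : ∀ q ∈ V, q.1 ∈ c.target ∧ c.symm q.1 ∈ e.baseSet := fun q hq => (hVsub hq).1.1
  have hVexp : ∀ q ∈ V, trivVec c e q ∈ expDomain g ∧ expMap g (trivVec c e q) ∈ c.source :=
    fun q hq => (hVsub hq).1.2
  have hVΨ : ∀ s, ι s ∈ V → s ∈ Ψ.source := fun s hs => by
    rw [← hV₀']; exact (hVsub hs).2
  -- the neighbourhood of the zero vector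
  let W₀ : Set (TangentBundle 𝓘(ℝ, H) X) := TotalSpace.proj ⁻¹' (c.source ∩ e.baseSet)
  let κ : TangentBundle 𝓘(ℝ, H) X → H × H := fun p => (c p.proj, (e p).2)
  have hproj : Continuous (TotalSpace.proj : TangentBundle 𝓘(ℝ, H) X → X) :=
    FiberBundle.continuous_proj H (TangentSpace 𝓘(ℝ, H))
  have hW₀ : IsOpen W₀ := (c.open_source.inter e.open_baseSet).preimage hproj
  have hκ : ContinuousOn κ W₀ := by
    refine (c.continuousOn.comp hproj.continuousOn fun p hp => hp.1).prodMk ?_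
    exact continuous_snd.comp_continuousOn
      (e.continuousOn.mono fun p hp => e.mem_source.2 hp.2)
  have hκθ : ∀ p ∈ W₀, trivVec c e (κ p) = p := fun p hp => trivVec_coord hp.1 hp.2
  have hθκ : ∀ q ∈ V, trivVec c e q ∈ W₀ ∧ κ (trivVec c e q) = q := by
    intro q hq
    have h1 := hVpar q hq
    have h2 := coord_trivVec h1.1 h1.2
    refine ⟨?_, Prod.ext h2.1 h2.2⟩
    rw [mem_preimage, trivVec_proj h1.2]
    exact ⟨c.map_target h1.1, h1.2⟩
  have hmemN : ∀ p ∈ W₀, (p ∈ normalSet g Y ↔ κ p ∈ range ι) := by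
    intro p hp
    constructor
    · intro h
      have hpY : p.proj ∈ Y := h.1
      exact ⟨(⟨_, (hYF _ hp.1).1 hpY⟩, ⟨_, (hK p hp.2 hpY).1 h⟩), rfl⟩
    · rintro ⟨⟨⟨f, hf⟩, ⟨k, hk⟩⟩, h⟩
      have h1 : f = c p.proj := congrArg Prod.fst h
      have h2 : k = (e p).2 := congrArg Prod.snd h
      subst h1 h2
      exact (hK p hp.2 ((hYF _ hp.1).2 hf)).2 hk
  let W := W₀ ∩ κ ⁻¹' V
  have hW : IsOpen W := hκ.isOpen_inter_preimage hW₀ hVo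
  have hsig : ∀ p ∈ normalSet g Y ∩ W, ∃ s, ι s = κ p ∧ ι s ∈ V := by
    rintro p ⟨hpN, hpW, hpV⟩
    obtain ⟨s, hs⟩ := (hmemN p hpW).1 hpN
    exact ⟨s, hs, hs ▸ hpV⟩
  have hval : ∀ p ∈ normalSet g Y ∩ W, ∀ s, ι s = κ p → expMap g p = c.symm (Ψ s) := by
    intro p hp s hs
    rw [hΨ]
    simp only [Φ, hs, hκθ p hp.2.1]
    rw [c.left_inv]
    have := (hVexp (κ p) hp.2.2).2
    rwa [hκθ p hp.2.1] at this
  have htarget : ∀ s, ι s ∈ V → Ψ s ∈ c.target := fun s hs => c.map_source (hVexp _ hs).2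
  refine ⟨W, hW, ?_, ⟨?_, ?_, ?_, ?_⟩⟩
  · have h0 : κ (⟨y, 0⟩ : TangentBundle 𝓘(ℝ, H) X) = (c y, 0) := by
      have h1 : (e (⟨y, 0⟩ : TangentBundle 𝓘(ℝ, H) X)).2 = 0 := by
        have h2 := congrFun (e.coe_linearMapAt_of_mem (R := ℝ) hye) 0
        exact h2.symm.trans (map_zero _)
      exact Prod.ext rfl h1
    exact ⟨⟨hyc, hye⟩, by rw [mem_preimage, h0]; exact hVx⟩
  · intro p hp
    have := (hVexp (κ p) hp.2.2).1
    rwa [hκθ p hp.2.1] at this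
  · intro p hp p' hp' h
    obtain ⟨s, hs, hsV⟩ := hsig p hp
    obtain ⟨s', hs', hsV'⟩ := hsig p' hp'
    rw [hval p hp s hs, hval p' hp' s' hs'] at h
    have h1 := Ψ.injOn (hVΨ s hsV) (hVΨ s' hsV')
      (c.symm.injOn (htarget s hsV) (htarget s' hsV') h)
    rw [← hκθ p hp.2.1, ← hκθ p' hp'.2.1, ← hs, ← hs', h1]
  · rw [continuousOn_iff_continuous_domRestrict]
    choose σ hσ hσV using fun p : ↥(normalSet g Y ∩ W) => hsig p.1 p.2
    have hσc : Continuous σ := by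
      rw [hι.continuous_iff]
      have : (ι ∘ σ) = fun p => κ p.1 := by ext1 p; exact hσ p
      rw [this]
      exact hκ.comp_continuous continuous_subtype_val fun p => p.2.2.1
    have : (normalSet g Y ∩ W).domRestrict (expMap g) = fun p => c.symm (Ψ (σ p)) := by
      ext1 p
      exact hval p.1 p.2 _ (hσ p)
    rw [this]
    exact c.continuousOn_symm.comp_continuous
      (Ψ.continuousOn.comp_continuous hσc fun p => hVΨ _ (hσV p)) fun p => htarget _ (hσV p)
  · intro O hO
    have hB₀ : IsOpen (V ∩ trivVec c e ⁻¹' O) :=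
      (continuousOn_trivVec.mono hVpar).isOpen_inter_preimage hVo hO
    have hB : IsOpen (ι ⁻¹' (V ∩ trivVec c e ⁻¹' O)) := hB₀.preimage ι.continuous
    have h1 : IsOpen (Ψ '' (ι ⁻¹' (V ∩ trivVec c e ⁻¹' O))) :=
      Ψ.isOpen_image_of_subset_source hB fun s hs => hVΨ s hs.1
    have h2 : IsOpen (c.symm '' (Ψ '' (ι ⁻¹' (V ∩ trivVec c e ⁻¹' O)))) := by
      refine c.symm.isOpen_image_of_subset_source h1 ?_
      rintro _ ⟨s, hs, rfl⟩
      exact htarget s hs.1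
    convert h2 using 1
    ext z
    simp only [mem_image, exists_exists_and_eq_and]
    constructor
    · rintro ⟨p, ⟨hp, hpO⟩, rfl⟩
      obtain ⟨s, hs, hsV⟩ := hsig p hp
      refine ⟨s, ⟨hsV, ?_⟩, (hval p hp s hs).symm⟩
      rwa [mem_preimage, hs, hκθ p hp.2.1]
    · rintro ⟨s, ⟨hsV, hsO⟩, rfl⟩
      obtain ⟨h3, h4⟩ := hθκ _ hsV
      have h5 : trivVec c e (ι s) ∈ normalSet g Y ∩ W :=
        ⟨(hmemN _ h3).2 ⟨s, h4.symm⟩, h3, by rw [mem_preimage, h4]; exact hsV⟩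
      exact ⟨_, ⟨h5, hsO⟩, hval _ h5 s h4.symm⟩

end LocalStructure


/-! ### The invariant distance, and the total tubular neighbourhood -/

section RiemannianDistance

variable {H : Type*} [NormedAddCommGroup H] [InnerProductSpace ℝ H]

section FibreNorm

variable {X : Type*} [PseudoEMetricSpace X] [ChartedSpace H X] [IsManifold 𝓘(ℝ, H) ∞ X]
  [RiemannianBundle fun x : X => TangentSpace 𝓘(ℝ, H) x]
  [IsContinuousRiemannianBundle H fun x : X => TangentSpace 𝓘(ℝ, H) x]

/-- Scalar multiplication in the fibres of the tangent bundle. -/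
@[reducible] noncomputable def tangentMulAction (X : Type*) [TopologicalSpace X]
    [ChartedSpace H X] :
    MulAction ℝ (TangentBundle 𝓘(ℝ, H) X) where
  smul t p := ⟨p.proj, t • p.2⟩
  one_smul p := congrArg (TotalSpace.mk p.proj) (one_smul ℝ p.2)
  mul_smul s t p := congrArg (TotalSpace.mk p.proj) (mul_smul s t p.2)

lemma continuous_tangent_smul (X : Type*) [TopologicalSpace X] [ChartedSpace H X]
    [IsManifold 𝓘(ℝ, H) ∞ X] :
    Continuous fun q : ℝ × TangentBundle 𝓘(ℝ, H) X =>
      (⟨q.2.proj, q.1 • q.2.2⟩ : TangentBundle 𝓘(ℝ, H) X) := by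
  have hproj : Continuous (TotalSpace.proj : TangentBundle 𝓘(ℝ, H) X → X) :=
    FiberBundle.continuous_proj H (TangentSpace 𝓘(ℝ, H))
  refine continuous_iff_continuousAt.2 fun q => ?_
  rw [FiberBundle.continuousAt_totalSpace]
  refine ⟨(hproj.comp continuous_snd).continuousAt, ?_⟩
  set e := trivializationAt H (TangentSpace 𝓘(ℝ, H)) q.2.proj
  have hq : q.2.proj ∈ e.baseSet := FiberBundle.mem_baseSet_trivializationAt' _
  have h1 : ContinuousAt (fun q : ℝ × TangentBundle 𝓘(ℝ, H) X => q.1 • (e q.2).2) q := by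
    refine continuousAt_fst.smul (continuous_snd.continuousAt.comp ?_)
    exact (e.continuousAt (e.mem_source.2 hq)).comp continuousAt_snd
  refine h1.congr ?_
  filter_upwards [(hproj.comp continuous_snd).continuousAt.eventually_mem
    (e.open_baseSet.mem_nhds hq)] with p hp
  have h2 := congrFun (e.coe_linearMapAt_of_mem (R := ℝ) hp)
  have h3 := h2 p.2.2
  have h4 := h2 (p.1 • p.2.2)
  rw [map_smul] at h4
  exact (congrArg _ h3.symm).trans h4

/-- The tangent bundle, with the norm given by a continuous Riemannian metric. -/
lemma isNormedBundle_tangentBundle :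
    letI := tangentMulAction (H := H) X
    IsNormedBundle (TotalSpace.proj : TangentBundle 𝓘(ℝ, H) X → X) (fun p => ‖p.2‖₊)
      (fun y => ⟨y, 0⟩) := by
  let := tangentMulAction (H := H) X
  refine ⟨FiberBundle.continuous_proj H (TangentSpace 𝓘(ℝ, H)), ?_, fun t p => rfl,
    fun t p => nnnorm_smul t p.2, fun y => rfl, fun t y => ?_, ?_⟩
  · have h1 : Continuous fun p : TangentBundle 𝓘(ℝ, H) X => inner ℝ p.2 p.2 :=
      Continuous.inner_bundle (F := H) (E := fun x : X => TangentSpace 𝓘(ℝ, H) x)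
        (b := fun p : TangentBundle 𝓘(ℝ, H) X => p.proj) (v := fun p => p.2)
        (w := fun p => p.2) continuous_id continuous_id
    have h2 : Continuous fun p : TangentBundle 𝓘(ℝ, H) X => ‖p.2‖ := by
      simp only [norm_eq_sqrt_real_inner]
      exact h1.sqrt
    exact h2.subtype_mk _
  · exact congrArg (TotalSpace.mk y) (smul_zero t)
  · intro y W hW hyW
    set e := trivializationAt H (TangentSpace 𝓘(ℝ, H)) y with he
    have hy : y ∈ e.baseSet := FiberBundle.mem_baseSet_trivializationAt' _
    obtain ⟨C, hC, hCe⟩ :=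
      eventually_norm_trivializationAt_lt H (fun x : X => TangentSpace 𝓘(ℝ, H) x) y
    have hy0 : e (⟨y, 0⟩ : TangentBundle 𝓘(ℝ, H) X) = (y, 0) := by
      have h2 := congrFun (e.coe_linearMapAt_of_mem (R := ℝ) hy) 0
      exact Prod.ext (e.coe_fst' hy) (h2.symm.trans (map_zero _))
    have h1 : e.toOpenPartialHomeomorph.symm ⁻¹' W ∈ 𝓝 (y, (0 : H)) := by
      refine (e.toOpenPartialHomeomorph.continuousAt_symm
        (e.mem_target.2 hy)).preimage_mem_nhds (hW.mem_nhds ?_)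
      have : e.toOpenPartialHomeomorph.symm (y, 0) = (⟨y, 0⟩ : TangentBundle 𝓘(ℝ, H) X) := by
        rw [← hy0]
        exact e.symm_apply_mk_proj (e.mem_source.2 hy)
      rwa [this]
    obtain ⟨A, hA, B, hB, hAB⟩ := mem_nhds_prod_iff.1 h1
    obtain ⟨δ, hδ, hδB⟩ := Metric.mem_nhds_iff.1 hB
    obtain ⟨c, hc, hcA⟩ := EMetric.mem_nhds_iff.1
      (inter_mem (inter_mem hA hCe) (e.open_baseSet.mem_nhds hy))
    refine ⟨min c (ENNReal.ofReal (δ / C)), lt_min hc (ENNReal.ofReal_pos.2 (div_pos hδ hC)), ?_⟩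
    rintro p ⟨h2, h3⟩
    obtain ⟨⟨h4, h5⟩, h6⟩ := hcA (show p.proj ∈ _ by
      rw [Metric.mem_eball, edist_comm]
      exact h2.trans_le (min_le_left _ _))
    have h7 : ‖p.2‖ < δ / C := by
      have := h3.trans_le (min_le_right _ _)
      rwa [ENNReal.lt_ofReal_iff_toReal_lt ENNReal.coe_ne_top] at this
    have h8 : ‖(e p).2‖ < δ := by
      have h9 := congrFun (e.coe_linearMapAt_of_mem (R := ℝ) h6) p.2
      have h10 : ‖e.continuousLinearMapAt ℝ p.proj p.2‖ ≤ C * ‖p.2‖ :=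
        (e.continuousLinearMapAt ℝ p.proj).le_of_opNorm_le h5.le p.2
      calc ‖(e p).2‖ = ‖e.continuousLinearMapAt ℝ p.proj p.2‖ := congrArg norm h9.symm
        _ ≤ C * ‖p.2‖ := h10
        _ < C * (δ / C) := by gcongr
        _ = δ := by field_simp
    have h9 : e.toOpenPartialHomeomorph.symm (p.proj, (e p).2) ∈ W :=
      hAB (mk_mem_prod h4 (hδB (by simpa using h8)))
    rwa [e.symm_apply_mk_proj (e.mem_source.2 h6)] at h9

end FibreNorm

lemma tangentAct_one {X : Type*} [TopologicalSpace X] [ChartedSpace H X] {G : Type*} [Group G]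
    [MulAction G X] (p : TangentBundle 𝓘(ℝ, H) X) : tangentAct (1 : G) p = p := by
  have : (fun x : X => (1 : G) • x) = id := funext fun x => one_smul G x
  rw [tangentAct, this, tangentMap_id]
  rfl

variable {X : Type*} [TopologicalSpace X] [ChartedSpace H X] [IsManifold 𝓘(ℝ, H) ∞ X]
  {g : StrongRiemannianMetric H X} {G : Type*} [Group G] [MulAction G X]

section Distance

variable [RiemannianBundle fun x : X => TangentSpace 𝓘(ℝ, H) x]

lemma ActsByIsometries.nnnorm_mfderiv (hG : ActsByIsometries G g)
    (hg : ∀ (x : X) (v w : TangentSpace 𝓘(ℝ, H) x), inner ℝ v w = g.inner x v w) (a : G) (x : X)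
    (v : TangentSpace 𝓘(ℝ, H) x) :
    ‖(mfderiv 𝓘(ℝ, H) 𝓘(ℝ, H) (fun z : X => a • z) x v : TangentSpace 𝓘(ℝ, H) (a • x))‖₊ =
      ‖v‖₊ := by
  apply NNReal.eq
  rw [coe_nnnorm, coe_nnnorm, norm_eq_sqrt_real_inner, norm_eq_sqrt_real_inner, hg, hg,
    hG.isometry]

/-- Isometries do not increase the Riemannian distance, as they preserve the length of paths. -/
lemma ActsByIsometries.riemannianEDist_smul_le (hG : ActsByIsometries G g)
    (hg : ∀ (x : X) (v w : TangentSpace 𝓘(ℝ, H) x), inner ℝ v w = g.inner x v w) (a : G)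
    (x y : X) : Manifold.riemannianEDist 𝓘(ℝ, H) (a • x) (a • y) ≤
      Manifold.riemannianEDist 𝓘(ℝ, H) x y := by
  refine le_of_forall_gt fun r hr => ?_
  obtain ⟨γ, h0, h1, hγ, hlen⟩ := Manifold.exists_lt_of_riemannianEDist_lt hr
  refine lt_of_le_of_lt ?_ hlen
  have hγa : ContMDiffOn 𝓘(ℝ, ℝ) 𝓘(ℝ, H) 1 (fun t => a • γ t) (Icc 0 1) :=
    ((hG.smooth a).of_le (by simp)).comp_contMDiffOn hγ
  refine (Manifold.riemannianEDist_le_pathELength hγa (by rw [h0]) (by rw [h1])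
    zero_le_one).trans_eq ?_
  rw [Manifold.pathELength_eq_lintegral_mfderiv_Ioo, Manifold.pathELength_eq_lintegral_mfderiv_Ioo]
  refine MeasureTheory.setLIntegral_congr_fun measurableSet_Ioo fun t ht => ?_
  have hd : MDifferentiableAt 𝓘(ℝ, ℝ) 𝓘(ℝ, H) γ t :=
    (hγ.contMDiffAt (Icc_mem_nhds ht.1 ht.2)).mdifferentiableAt one_ne_zero
  have hc : mfderiv 𝓘(ℝ, ℝ) 𝓘(ℝ, H) (fun t => a • γ t) t =
      (mfderiv 𝓘(ℝ, H) 𝓘(ℝ, H) (fun z : X => a • z) (γ t)).comp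
        (mfderiv 𝓘(ℝ, ℝ) 𝓘(ℝ, H) γ t) :=
    mfderiv_comp (g := fun z : X => a • z) t ((hG.smooth a).mdifferentiableAt (by simp)) hd
  rw [hc]
  exact congrArg (fun r : NNReal => (r : ENNReal)) (hG.nnnorm_mfderiv hg a (γ t) _)

end Distance

lemma ActsByIsometries.tangentAct_mul (hG : ActsByIsometries G g) (a b : G)
    (p : TangentBundle 𝓘(ℝ, H) X) : tangentAct (a * b) p = tangentAct a (tangentAct b p) := by
  have : (fun x : X => (a * b) • x) = (fun x : X => a • x) ∘ fun x : X => b • x :=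
    funext fun x => mul_smul a b x
  rw [tangentAct, this]
  exact tangentMap_comp_at p ((hG.smooth a).mdifferentiableAt (by simp))
    ((hG.smooth b).mdifferentiableAt (by simp))

/-- The action of `G` on the tangent bundle by derivatives. -/
@[reducible] noncomputable def ActsByIsometries.tangentBundleAction (hG : ActsByIsometries G g) :
    MulAction G (TangentBundle 𝓘(ℝ, H) X) where
  smul := tangentAct
  one_smul := tangentAct_one
  mul_smul := hG.tangentAct_mul

lemma ActsByIsometries.tangentAct_mem_tangentSet (hG : ActsByIsometries G g) {Y : Set X}
    (hGY : ∀ a : G, ∀ y ∈ Y, a • y ∈ Y) (a : G) {p : TangentBundle 𝓘(ℝ, H) X}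
    (hp : p ∈ tangentSet Y) : tangentAct a p ∈ tangentSet Y := by
  obtain ⟨γ, hγ, hY, rfl⟩ := hp
  refine ⟨fun t => a • γ t, (hG.smooth a).contMDiffAt.comp 0 hγ, hY.mono fun t => hGY a _, ?_⟩
  exact tangentMap_comp_at (I := 𝓘(ℝ, ℝ)) (I' := 𝓘(ℝ, H)) (I'' := 𝓘(ℝ, H))
    (f := γ) (g := fun x : X => a • x) ⟨0, (1 : ℝ)⟩
    ((hG.smooth a).mdifferentiableAt (by simp)) (hγ.mdifferentiableAt (by simp))

lemma ActsByIsometries.tangentAct_mem_normalSet (hG : ActsByIsometries G g) {Y : Set X}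
    (hGY : ∀ a : G, ∀ y ∈ Y, a • y ∈ Y) (a : G) {p : TangentBundle 𝓘(ℝ, H) X}
    (hp : p ∈ normalSet g Y) : tangentAct a p ∈ normalSet g Y := by
  obtain ⟨x, v⟩ := p
  refine ⟨hGY a _ hp.1, fun w hw => ?_⟩
  have h1 := hG.tangentAct_mem_tangentSet hGY a⁻¹ hw
  have h2 : tangentAct a (tangentAct a⁻¹ (⟨a • x, w⟩ : TangentBundle 𝓘(ℝ, H) X)) = ⟨a • x, w⟩ := by
    rw [← hG.tangentAct_mul, mul_inv_cancel, tangentAct_one]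
  have h3 : ∀ q : TangentBundle 𝓘(ℝ, H) X, q.proj = x →
      ∃ u : TangentSpace 𝓘(ℝ, H) x, q = ⟨x, u⟩ := by
    rintro ⟨_, u⟩ rfl
    exact ⟨u, rfl⟩
  obtain ⟨u, hu⟩ := h3 (tangentAct a⁻¹ (⟨a • x, w⟩ : TangentBundle 𝓘(ℝ, H) X))
    (inv_smul_smul a x)
  have h4 : mfderiv 𝓘(ℝ, H) 𝓘(ℝ, H) (fun z : X => a • z) x u = w := by
    have h5 : tangentAct a (⟨x, u⟩ : TangentBundle 𝓘(ℝ, H) X) = ⟨a • x, w⟩ := by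
      rw [← hu]
      exact h2
    exact eq_of_heq (TotalSpace.mk.inj h5).2
  have h6 : (⟨x, u⟩ : TangentBundle 𝓘(ℝ, H) X) ∈ tangentSet Y := by
    rw [← hu]
    exact h1
  have h7 := hG.isometry a x v u
  rw [hp.2 u h6, h4] at h7
  exact h7

/-- The total equivariant tubular neighbourhood, for a metric on `X` which is invariant under `G`
and which induces the topology of `X`. -/
lemma exists_tubularNeighborhood_of_isIsometricSMul [CompleteSpace H] {X : Type*}
    [PseudoEMetricSpace X] [T2Space X] [ChartedSpace H X] [IsManifold 𝓘(ℝ, H) ∞ X]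
    [RiemannianBundle fun x : X => TangentSpace 𝓘(ℝ, H) x]
    [IsContinuousRiemannianBundle H fun x : X => TangentSpace 𝓘(ℝ, H) x]
    [MulAction G X] [IsIsometricSMul G X] {g : StrongRiemannianMetric H X}
    (hg : ∀ (x : X) (v w : TangentSpace 𝓘(ℝ, H) x), inner ℝ v w = g.inner x v w)
    (hG : ActsByIsometries G g) {Y : Set X} (hY : IsSubmanifold (H := H) Y)
    (hGY : ∀ a : G, ∀ y ∈ Y, a • y ∈ Y) (hN : IsSmoothSubbundleOver Y (normalSet g Y)) :
    ∃ T : TubularNeighborhood g Y, T.IsTotal ∧ T.IsInvariant G ∧ T.IsEquivariant G := by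
  let := tangentMulAction (H := H) X
  let := hG.tangentBundleAction
  have : ContinuousSMul ℝ (TangentBundle 𝓘(ℝ, H) X) := ⟨continuous_tangent_smul X⟩
  have : ContinuousConstSMul G (TangentBundle 𝓘(ℝ, H) X) :=
    ⟨fun a => (hG.smooth a).continuous_tangentMap (by simp)⟩
  have : SMulCommClass G ℝ (TangentBundle 𝓘(ℝ, H) X) :=
    ⟨fun a t p => congrArg (TotalSpace.mk (a • p.proj))
      (map_smul (mfderiv 𝓘(ℝ, H) 𝓘(ℝ, H) (fun z : X => a • z) p.proj) t p.2)⟩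
  have hzero : ∀ y ∈ Y, (⟨y, 0⟩ : TangentBundle 𝓘(ℝ, H) X) ∈ normalSet g Y :=
    fun y hy => ⟨hy, fun w _ => by simp⟩
  have ha : IsEquivariantExp G (TotalSpace.proj : TangentBundle 𝓘(ℝ, H) X → X)
      (fun p => ‖p.2‖₊) (normalSet g Y) (expDomain g) (expMap g) :=
    ⟨fun _ _ => rfl, fun a p => hG.nnnorm_mfderiv hg a p.proj p.2,
      fun a _ hp => hG.tangentAct_mem_normalSet hGY a hp,
      fun a _ hp => tangentAct_mem_expDomain hG a hp, fun a _ hp => expMap_tangentAct hG a hp⟩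
  obtain ⟨U, φ, hU, hφ, hφa⟩ := exists_total_equivariant_tube
    (isNormedBundle_tangentBundle (H := H) (X := X)) ha (Y := Y) (fun p hp => hp.1)
    (fun t p hp => ⟨hp.1, fun w hw => by
      have h1 : g.inner p.proj (t • p.2) w = t * g.inner p.proj p.2 w := by simp
      have h2 : g.inner p.proj p.2 w = 0 := hp.2 w hw
      rw [h2, mul_zero] at h1
      exact h1⟩)
    hzero expMap_zero (fun y hy => exists_openEmbedsOn_expMap hY hN hy)
  refine ⟨⟨normalSet g Y, ⟨univ, isOpen_univ, (inter_univ _).symm⟩, hzero, U, hU,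
    fun y hy => ?_, φ, hφ⟩, rfl, fun a x hx => ?_, fun a p => ⟨_, hφa a p⟩⟩
  · rw [← hφ y hy]
    exact (φ _).2
  · obtain ⟨p, hp⟩ := φ.surjective ⟨x, hx⟩
    have h := hφa a p
    rw [hp] at h
    change a • x ∈ U
    rw [← h]
    exact (φ _).2

end RiemannianDistance

end InvTubular

theorem theorem2p5
    {H : Type*} [NormedAddCommGroup H] [InnerProductSpace ℝ H] [CompleteSpace H]
    {X : Type*} [TopologicalSpace X] [T3Space X] [ChartedSpace H X] [IsManifold 𝓘(ℝ, H) ∞ X]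
    (g : InvTubular.StrongRiemannianMetric H X)
    {G : Type*} [Group G] [MulAction G X] (hG : InvTubular.ActsByIsometries G g)
    (Y : Set X) (hY : InvTubular.IsSubmanifold (H := H) Y)
    (hGY : ∀ a : G, ∀ y ∈ Y, a • y ∈ Y)
    (hN : InvTubular.IsSmoothSubbundleOver Y (InvTubular.normalSet g Y)) :
    ∃ T : InvTubular.TubularNeighborhood g Y,
      T.IsTotal ∧ T.IsInvariant G ∧ T.IsEquivariant G := by
  let : RiemannianBundle (fun x : X => TangentSpace 𝓘(ℝ, H) x) := ⟨g.toRiemannianMetric⟩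
  have hg : ∀ (x : X) (v w : TangentSpace 𝓘(ℝ, H) x), inner ℝ v w = g.inner x v w :=
    fun _ _ _ => rfl
  have hc : IsContinuousRiemannianBundle H (fun x : X => TangentSpace 𝓘(ℝ, H) x) :=
    ⟨⟨g.inner, g.contMDiff.continuous, hg⟩⟩
  -- the Riemannian distance of `g`, which induces the given topology as `X` is regular
  let m : PseudoEMetricSpace X := .ofRiemannianMetric 𝓘(ℝ, H) X
  have hm : IsIsometricSMul G X := ⟨fun a x y => by
    refine le_antisymm (hG.riemannianEDist_smul_le hg a x y) ?_
    have h := hG.riemannianEDist_smul_le hg a⁻¹ (a • x) (a • y)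
    rw [inv_smul_smul, inv_smul_smul] at h
    exact h⟩
  exact InvTubular.exists_tubularNeighborhood_of_isIsometricSMul hg hG hY hGY hN
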